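/- Let $\mathfrak o$ be a compact discrete valuation ring of characteristic $0$ with maximal ideal $\wp$, fixed uniformizer $\pi$, and finite residue field $\mathbb F_q$ of characteristic $2$. Let $\mathrm e$ be its ramification index, i.e. $2\mathfrak o=\wp^{\mathrm e}$. For $k\ge 1$ put $\mathfrak o_k=\mathfrak o/\wp^k$. Let $r\ge 4\mathrm e+2$, $\ell=\lceil r/2\rceil$, $\ell'=\lfloor r/2\rfloor$, and let $M^\ell=I+\pi^\ell M_2(\mathfrak o_r)\le \mathrm{GL}_2(\mathfrak o_r)$. Fix a character $\psi:\mathfrak o_r\to\mathbb C^\times$ of the additive group with $\psi(\pi^{r-1})\ne 1$. For $A\in M_2(\mathfrak o_{\ell'})$ let $\psi_A:M^\ell\to\mathbb C^\times$ be the character $\psi_A(I+\pi^\ell B)=\psi(\pi^\ell\,\mathrm{trace}(\tilde A B))$, where $\tilde A\in M_2(\mathfrak o_r)$ is any lift of $A$ (it does not depend on the lift), and let $C_{\mathrm{GL}_2(\mathfrak o_{\ell'})}(A)=\{X\in \mathrm{GL}_2(\mathfrak o_{\ell'})\mid AX=XA\}$. Theorem 1.2. Let $A\in M_2(\mathfrak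 o_{\ell'})$ be cyclic, i.e. there is a vector $v\in\mathfrak o_{\ell'}^2$ such that $v$ and $Av$ generate $\mathfrak o_{\ell'}^2$. Let $\rho$ be a (finite-dimensional complex) irreducible representation of $\mathrm{GL}_2(\mathfrak o_r)$ which is a constituent of $\mathrm{Ind}_{M^\ell}^{\mathrm{GL}_2(\mathfrak o_r)}(\psi_A)$. 1. If $\mathrm{trace}(A)\in\mathfrak o_{\ell'}^\times$, then the restriction of $\rho$ to $\mathrm{SL}_2(\mathfrak o_r)$ is irreducible. 2. If $\mathrm{trace}(A)\in\pi\mathfrak o_{\ell'}$, then the restriction of $\rho$ to $\mathrm{SL}_2(\mathfrak o_r)$ is a direct sum of exactly $$\frac{(q-1)q^{\ell'-1}}{|\det(C_{\mathrm{GL}_2(\mathfrak o_{\ell'})}(A))|}$$ irreducible representations, each of dimension $$\frac{\dim(\rho)\cdot|\det(C_{\mathrm{GL}_2(\mathfrak o_{\ell'})}(A))|}{(q-1)q^{\ell'-1}}.$$ -/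

import Mathlib

open IsLocalRing

noncomputable section

namespace SL2Branching

/-- The finite quotient `𝔬_k = 𝔬 / ℘ ^ k`, where `℘` is the maximal ideal of `𝔬`. -/
abbrev Quo (𝔬 : Type*) [CommRing 𝔬] [IsLocalRing 𝔬] (k : ℕ) : Type _ :=
  𝔬 ⧸ maximalIdeal 𝔬 ^ k

/-- A `2 × 2` matrix `A` over `R` is cyclic if some vector `v` is such that `v` and `A v`
generate `R ⊕ R` (two generators of a free module of rank two form a basis). -/
def IsCyclicMatrix {R : Type*} [CommRing R] (A : Matrix (Fin 2) (Fin 2) R) : Prop :=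
  ∃ v : Fin 2 → R, Submodule.span R {v, A.mulVec v} = ⊤

/-- The centralizer `{X ∈ GL₂(R) ∣ A X = X A}` of a matrix `A ∈ M₂(R)`. -/
def glCentralizer {R : Type*} [CommRing R] (A : Matrix (Fin 2) (Fin 2) R) :
    Subgroup (GL (Fin 2) R) where
  carrier := {X | A * (X : Matrix (Fin 2) (Fin 2) R) = (X : Matrix (Fin 2) (Fin 2) R) * A}
  one_mem' := by simp
  mul_mem' {X Y} hX hY := by
    simp only [Set.mem_ofPred_eq, Units.val_mul] at *
    rw [← mul_assoc, hX, mul_assoc, hY, mul_assoc]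
  inv_mem' {X} hX := by
    simp only [Set.mem_ofPred_eq] at *
    have h : Commute A (X : Matrix (Fin 2) (Fin 2) R) := hX
    exact h.units_inv_right

/-- The order of the group `det (C_{GL₂(R)}(A))` of determinants of elements of the centralizer. -/
def cardDetCentralizer {R : Type*} [CommRing R] (A : Matrix (Fin 2) (Fin 2) R) : ℕ :=
  Nat.card ((glCentralizer A).map (Matrix.GeneralLinearGroup.det : GL (Fin 2) R →* Rˣ))

/-- The subgroup `I + ϖ M₂(R)` of `GL₂(R)`, i.e. the invertible matrices of the form `I + ϖ B`. -/
def congruenceSubgroup {R : Type*} [CommRing R] (ϖ : R) : Subgroup (GL (Fin 2) R) where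
  carrier := {g | ∃ B : Matrix (Fin 2) (Fin 2) R, (g : Matrix (Fin 2) (Fin 2) R) = 1 + ϖ • B}
  one_mem' := ⟨0, by simp⟩
  mul_mem' := by
    rintro g h ⟨B, hB⟩ ⟨C, hC⟩
    refine ⟨B + C + ϖ • (B * C), ?_⟩
    rw [Units.val_mul, hB, hC]
    simp only [mul_add, add_mul, one_mul, mul_one, smul_add, smul_mul_assoc, mul_smul_comm]
    abel
  inv_mem' := by
    rintro g ⟨B, hB⟩
    refine ⟨-(((g⁻¹ : GL (Fin 2) R) : Matrix (Fin 2) (Fin 2) R) * B), ?_⟩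
    have h : ((g⁻¹ : GL (Fin 2) R) : Matrix (Fin 2) (Fin 2) R)
        * (g : Matrix (Fin 2) (Fin 2) R) = 1 := g.inv_mul
    rw [hB, mul_add, mul_one, mul_smul_comm] at h
    rw [smul_neg, ← h]
    abel

variable {𝔬 : Type*} [CommRing 𝔬] [IsDomain 𝔬] [IsDiscreteValuationRing 𝔬]

/-- The congruence subgroup `M^i = I + π ^ i M₂(𝔬_r)` of `GL₂(𝔬_r)`. -/
abbrev congGL (π : 𝔬) (r i : ℕ) : Subgroup (GL (Fin 2) (Quo 𝔬 r)) :=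
  congruenceSubgroup (Ideal.Quotient.mk (maximalIdeal 𝔬 ^ r) π ^ i)

/-- A (chosen) entrywise lift of a matrix over `𝔬_k` to a matrix over `𝔬_r`. -/
def matrixLift {k : ℕ} (r : ℕ) (A : Matrix (Fin 2) (Fin 2) (Quo 𝔬 k)) :
    Matrix (Fin 2) (Fin 2) (Quo 𝔬 r) :=
  A.map fun x => Ideal.Quotient.mk (maximalIdeal 𝔬 ^ r) (Quotient.out x)

theorem pi_pow_eq_zero {π : 𝔬} (hπ : Irreducible π) {r n : ℕ} (h : r ≤ n) :
    Ideal.Quotient.mk (maximalIdeal 𝔬 ^ r) π ^ n = 0 := by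
  rw [← map_pow, Ideal.Quotient.eq_zero_iff_mem]
  have : π ∈ maximalIdeal 𝔬 := (mem_maximalIdeal π).2 hπ.not_isUnit
  exact Ideal.pow_le_pow_right h (Ideal.pow_mem_pow this n)

/-- The character `ψ_A` of `M^ℓ` (`ℓ = ⌈r/2⌉`) for `A ∈ M₂(𝔬_ℓ')` (`ℓ' = ⌊r/2⌋`), given by
`ψ_A (I + π ^ ℓ B) = ψ (π ^ ℓ trace (Ã B)) = ψ (trace (Ã (g - I)))` with `g = I + π ^ ℓ B` and
`Ã ∈ M₂(𝔬_r)` a lift of `A`; see `psiA_apply` for the first form and arbitrary lifts. -/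
def psiA {π : 𝔬} (hπ : Irreducible π) {r : ℕ} (ψ : AddChar (Quo 𝔬 r) ℂ)
    (A : Matrix (Fin 2) (Fin 2) (Quo 𝔬 (r / 2))) : congGL π r ((r + 1) / 2) →* ℂ where
  toFun g := ψ (Matrix.trace (matrixLift r A *
    (((g : GL (Fin 2) (Quo 𝔬 r)) : Matrix (Fin 2) (Fin 2) (Quo 𝔬 r)) - 1)))
  map_one' := by simp
  map_mul' := by
    rintro ⟨g, B, hB⟩ ⟨h, C, hC⟩
    rw [← AddChar.map_add_eq_mul, ← Matrix.trace_add, ← mul_add]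
    congr 3
    simp only [Subgroup.coe_mul, Units.val_mul, hB, hC]
    have h0 : Ideal.Quotient.mk (maximalIdeal 𝔬 ^ r) π ^ ((r + 1) / 2) *
        Ideal.Quotient.mk (maximalIdeal 𝔬 ^ r) π ^ ((r + 1) / 2) = 0 := by
      rw [← pow_add]
      exact pi_pow_eq_zero hπ (by omega)
    simp only [mul_add, add_mul, one_mul, mul_one, smul_mul_assoc, mul_smul_comm, smul_add, smul_smul, h0,
      zero_smul]
    abel

theorem psiA_apply {π : 𝔬} (hπ : Irreducible π) {r : ℕ} (ψ : AddChar (Quo 𝔬 r) ℂ)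
    (A : Matrix (Fin 2) (Fin 2) (Quo 𝔬 (r / 2))) (A' : Matrix (Fin 2) (Fin 2) (Quo 𝔬 r))
    (hA' : A'.map (Ideal.Quotient.factorPow (maximalIdeal 𝔬) (Nat.div_le_self r 2)) = A)
    (g : congGL π r ((r + 1) / 2)) (B : Matrix (Fin 2) (Fin 2) (Quo 𝔬 r))
    (hg : ((g : GL (Fin 2) (Quo 𝔬 r)) : Matrix (Fin 2) (Fin 2) (Quo 𝔬 r)) =
      1 + Ideal.Quotient.mk (maximalIdeal 𝔬 ^ r) π ^ ((r + 1) / 2) • B) :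
    psiA hπ ψ A g =
      ψ (Ideal.Quotient.mk (maximalIdeal 𝔬 ^ r) π ^ ((r + 1) / 2) * Matrix.trace (A' * B)) := by
  have key : Ideal.Quotient.mk (maximalIdeal 𝔬 ^ r) π ^ ((r + 1) / 2) • matrixLift r A =
      Ideal.Quotient.mk (maximalIdeal 𝔬 ^ r) π ^ ((r + 1) / 2) • A' := by
    ext i j
    obtain ⟨a, ha⟩ := Ideal.Quotient.mk_surjective (A' i j)
    have h1 : Ideal.Quotient.mk (maximalIdeal 𝔬 ^ (r / 2)) a = A i j := by
      rw [← hA', Matrix.map_apply, ← ha]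
      rfl
    have h2 : Ideal.Quotient.mk (maximalIdeal 𝔬 ^ (r / 2)) (Quotient.out (A i j)) = A i j :=
      Quotient.out_eq (A i j)
    have h3 : Quotient.out (A i j) - a ∈ maximalIdeal 𝔬 ^ (r / 2) := by
      rw [← Ideal.Quotient.eq, h1, h2]
    have h4 : π ^ ((r + 1) / 2) * (Quotient.out (A i j) - a) ∈ maximalIdeal 𝔬 ^ r := by
      have hp : π ∈ maximalIdeal 𝔬 := (mem_maximalIdeal π).2 hπ.not_isUnit
      have := Ideal.mul_mem_mul (Ideal.pow_mem_pow hp ((r + 1) / 2)) h3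
      rw [← pow_add] at this
      exact Ideal.pow_le_pow_right (by omega) this
    simp only [Matrix.smul_apply, matrixLift, Matrix.map_apply, smul_eq_mul, ← ha, ← map_pow,
      ← map_mul]
    rw [Ideal.Quotient.eq, ← mul_sub]
    exact h4
  change ψ _ = ψ _
  rw [hg, add_sub_cancel_left, mul_smul_comm, ← smul_mul_assoc, key, smul_mul_assoc,
    Matrix.trace_smul, smul_eq_mul]

/-- The one-dimensional complex representation given by a multiplicative character. -/
def charRep {H : Type*} [Group H] (χ : H →* ℂ) : Representation ℂ H ℂ :=
  (Algebra.lmul ℂ ℂ : ℂ →* Module.End ℂ ℂ).comp χ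

/-- `ρ` belongs to `Irr (G ∣ φ)`: it is irreducible, and it is a constituent of the induced
representation `Ind_H^G φ`, i.e. it is isomorphic to a subrepresentation of it. -/
def IsIrrOver {G : Type*} [Group G] {H : Subgroup G} {W V : Type*}
    [AddCommGroup W] [Module ℂ W] [AddCommGroup V] [Module ℂ V]
    (φ : Representation ℂ H W) (ρ : Representation ℂ G V) : Prop :=
  ρ.IsIrreducible ∧
    ∃ f : Representation.IntertwiningMap ρ (Representation.ind H.subtype φ), Function.Injective f

/-- The restriction of a representation of `GL₂(R)` to `SL₂(R)`. -/
def resSL {R : Type*} [CommRing R] {V : Type*} [AddCommGroup V] [Module ℂ V]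
    (ρ : Representation ℂ (GL (Fin 2) R) V) :
    Representation ℂ (Matrix.SpecialLinearGroup (Fin 2) R) V :=
  ρ.comp Matrix.SpecialLinearGroup.toGL

/-- `σ` is a direct sum of exactly `n` irreducible representations, all of dimension `d`. -/
def IsSumOfIrreducibles {G : Type*} [Group G] {V : Type*} [AddCommGroup V] [Module ℂ V]
    (σ : Representation ℂ G V) (n d : ℕ) : Prop :=
  ∃ W : Fin n → Subrepresentation σ,
    DirectSum.IsInternal (fun i => (W i).toSubmodule) ∧
      ∀ i, (W i).toRepresentation.IsIrreducible ∧ Module.finrank ℂ (W i).toSubmodule = d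

end SL2Branching

end

/-! Write `R` for 𝔬_r, k = ⌊r/2⌋, l = ⌈r/2⌉, M^i = I + π^i M₂(R), and H for the group of matrices of
square determinant. Since H = (scalars)·SL₂(R) and scalars act on ρ by scalars, SL₂(R) and H have
the same invariant subspaces. Because r ≥ 4e + 2, every element of 1 + π^k R is a square
(`IsChainRing.isSquare_one_add`), so M^k ≤ H.

Let W be the ψ_A-eigenspace of M^l in ρ, and let I be the stabilizer of ψ_A, which equals C(Ã) M^k
(`RegularDatum.exists_eq_mul`). By Clifford theory I acts irreducibly on W. The crux is that H ∩ I
still does (`RegularDatum.isIrrOn_squareDet_inf`). Then the H-module generated by W is irreducible,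
and ρ is the direct sum of its translates over G/HI. The group HI consists of the matrices whose
determinant modulo π^k lies in det C(A), so its index is |𝔬_k^×| / |det C(A)|. If tr A is a unit,
determinants from C(Ã) exhaust the units modulo squares, so HI = G.

The crux has three cases. If tr A is a unit, every element of C(Ã) is a square times an element
congruent to 1 modulo π, and the latter acts on W by a scalar. If k = l, then M^k acts on W by
scalars and C(Ã) is abelian, so W is a line. If l = k + 1 and tr A is not a unit, A reduces to s + n
with n ≠ 0 and n² = 0. The commutator form on M^k/M^l is tr(n[B, B']), and n^⊥ = {B : tr(nB) = 0} is
isotropic for it. After changing the lift Ã, the centralizer commutes on W with the subgroup P of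
M^k attached to n^⊥. A weight space of P in W then has stabilizer C(Ã)P, which acts through
commuting operators, and its translates under M^k ≤ H fill W. -/

noncomputable section
namespace SL2Branching

/-! ### Clifford theory for weight spaces inside a fixed representation. -/

section Clifford

variable {G V : Type*} [Group G] [AddCommGroup V] [Module ℂ V] (ρ : Representation ℂ G V)

/-- The simultaneous eigenspace of the operators `ρ n`, `n ∈ N`, for the eigenvalues `φ n`. -/
def weightSpace (N : Subgroup G) (φ : N → ℂ) : Submodule ℂ V :=
  ⨅ n : N, Module.End.eigenspace (ρ n) (φ n)

/-- The subspace `W` is stable under the subgroup `L`. -/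
def IsStable (L : Subgroup G) (W : Submodule ℂ V) : Prop :=
  ∀ g ∈ L, ∀ v ∈ W, ρ g v ∈ W

/-- The subgroup `L` acts irreducibly on the subspace `W`. -/
structure IsIrrOn (L : Subgroup G) (W : Submodule ℂ V) : Prop where
  ne_bot : W ≠ ⊥
  stable : IsStable ρ L W
  eq_of_le : ∀ U ≤ W, U ≠ ⊥ → IsStable ρ L U → U = W

/-- The smallest `L`-stable subspace containing `U`. -/
def orbitSup (L : Subgroup G) (U : Submodule ℂ V) : Submodule ℂ V :=
  ⨆ g : L, U.map (ρ g)

variable {ρ}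

theorem mem_weightSpace {N : Subgroup G} {φ : N → ℂ} {v : V} :
    v ∈ weightSpace ρ N φ ↔ ∀ n : N, ρ n v = φ n • v := by
  simp [weightSpace]

theorem iSupIndep_weightSpace (N : Subgroup G) : iSupIndep (weightSpace ρ N) :=
  iSupIndep.iInf (fun n : N => Module.End.eigenspace (ρ n))
    (fun n => Module.End.eigenspaces_iSupIndep (ρ n))

/-- This is ρ(n)ρ(g) = ρ(g)ρ(g⁻¹ng). The conjugate is supplied as an element of `N`, so that
normality is needed only for the `g` at hand. -/
theorem apply_mem_weightSpace {N : Subgroup G} {φ φ' : N → ℂ} {g : G}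
    (h : ∀ n : N, ∃ m : N, (m : G) = g⁻¹ * n * g ∧ φ' n = φ m) {v : V}
    (hv : v ∈ weightSpace ρ N φ) : ρ g v ∈ weightSpace ρ N φ' := by
  rw [mem_weightSpace] at *
  intro n
  obtain ⟨m, hm, hmn⟩ := h n
  have : (n : G) * g = g * m := by rw [hm]; group
  rw [← Module.End.mul_apply, ← map_mul, this, map_mul, Module.End.mul_apply, hv, map_smul, hmn]

theorem apply_inv_apply (g : G) (v : V) : ρ g⁻¹ (ρ g v) = v := by
  rw [← Module.End.mul_apply, ← map_mul]; simp

theorem apply_apply_inv (g : G) (v : V) : ρ g (ρ g⁻¹ v) = v := by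
  rw [← Module.End.mul_apply, ← map_mul]; simp

theorem IsStable.mono {L L' : Subgroup G} (h : L ≤ L') {W : Submodule ℂ V}
    (hW : IsStable ρ L' W) : IsStable ρ L W := fun g hg => hW g (h hg)

theorem IsStable.inf {L : Subgroup G} {W U : Submodule ℂ V}
    (hW : IsStable ρ L W) (hU : IsStable ρ L U) : IsStable ρ L (W ⊓ U) :=
  fun g hg v hv => ⟨hW g hg v hv.1, hU g hg v hv.2⟩

theorem le_orbitSup (L : Subgroup G) (U : Submodule ℂ V) : U ≤ orbitSup ρ L U := by
  intro v hv
  exact Submodule.mem_iSup_of_mem (1 : L) ⟨v, hv, by simp⟩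

theorem isStable_orbitSup (L : Subgroup G) (U : Submodule ℂ V) :
    IsStable ρ L (orbitSup ρ L U) := by
  intro g hg v hv
  suffices orbitSup ρ L U ≤ (orbitSup ρ L U).comap (ρ g) from this hv
  refine iSup_le fun h => ?_
  rw [← Submodule.map_le_iff_le_comap, ← Submodule.map_comp]
  refine le_trans (le_of_eq ?_) (le_iSup _ (⟨g, hg⟩ * h : L))
  simp [Module.End.mul_eq_comp]

theorem orbitSup_le {L : Subgroup G} {U W : Submodule ℂ V} (hUW : U ≤ W) (hW : IsStable ρ L W) :
    orbitSup ρ L U ≤ W := by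
  refine iSup_le fun h => ?_
  rintro _ ⟨v, hv, rfl⟩
  exact hW h h.2 v (hUW hv)

theorem IsIrrOn.orbitSup_eq {L : Subgroup G} {W : Submodule ℂ V} (hW : IsIrrOn ρ L W)
    {U : Submodule ℂ V} (hUW : U ≤ W) (hU : U ≠ ⊥) : orbitSup ρ L U = W :=
  hW.eq_of_le _ (orbitSup_le hUW hW.stable)
    (fun h => hU (le_bot_iff.1 ((le_orbitSup L U).trans h.le))) (isStable_orbitSup L U)

/-- Members of a sum of independent subspaces have their components in smaller subspaces. -/
theorem inf_iSup_le_of_iSupIndep {ι : Type*} {E F : ι → Submodule ℂ V} (hE : iSupIndep E)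
    (hFE : F ≤ E) (i : ι) : E i ⊓ ⨆ j, F j ≤ F i := by
  have h : (⨆ (j) (_ : j ≠ i), F j) ⊓ E i = ⊥ :=
    (Disjoint.mono_left (iSup₂_mono fun j _ => hFE j) (hE i).symm).eq_bot
  rw [iSup_split_single F i, inf_comm, sup_inf_assoc_of_le _ (hFE i), h, sup_bot_eq]

/-- Clifford theory: a weight space of an irreducible representation is irreducible for the
stabilizer of the weight. -/
theorem IsIrrOn.inf_weightSpace {L : Subgroup G} {W : Submodule ℂ V} (hW : IsIrrOn ρ L W)
    {N I : Subgroup G} (hN : ∀ g ∈ L, ∀ n ∈ N, g⁻¹ * n * g ∈ N) (hIL : I ≤ L) (φ : N → ℂ)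
    (hI : ∀ g (hg : g ∈ L), g ∈ I ↔ ∀ n : N, φ ⟨g⁻¹ * n * g, hN g hg n n.2⟩ = φ n)
    (hne : W ⊓ weightSpace ρ N φ ≠ ⊥) : IsIrrOn ρ I (W ⊓ weightSpace ρ N φ) := by
  refine ⟨hne, (hW.stable.mono hIL).inf fun g hg v hv => ?_, fun U hUW hU hUI => ?_⟩
  · exact apply_mem_weightSpace
      (fun n => ⟨⟨_, hN g (hIL hg) n n.2⟩, rfl, ((hI g (hIL hg)).1 hg n).symm⟩) hv
  -- `F φ'` gathers the translates of `U` of weight `φ'`. Together they span `W`, so independence of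
  -- weights puts the `φ`-part of `W` inside `F φ`, a sum of translates of `U` by the stabilizer.
  let F : (N → ℂ) → Submodule ℂ V := fun φ' =>
    ⨆ (g : L) (_ : ∀ n : N, φ ⟨_, hN g g.2 n n.2⟩ = φ' n), U.map (ρ g)
  have hF : F ≤ weightSpace ρ N := by
    intro φ'
    refine iSup₂_le fun g hg => ?_
    rintro _ ⟨v, hv, rfl⟩
    exact apply_mem_weightSpace (fun n => ⟨⟨_, hN g g.2 n n.2⟩, rfl, (hg n).symm⟩) (hUW hv).2
  have hFW : W ≤ ⨆ φ', F φ' := by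
    rw [← hW.orbitSup_eq (hUW.trans inf_le_left) hU]
    refine iSup_le fun g => ?_
    exact le_iSup_of_le (fun n : N => φ ⟨_, hN g g.2 n n.2⟩)
      (le_iSup₂_of_le g (fun _ => rfl) le_rfl)
  have hFU : F φ ≤ U := by
    refine iSup₂_le fun g hg => ?_
    rintro _ ⟨v, hv, rfl⟩
    exact hUI g ((hI g g.2).2 hg) v hv
  refine le_antisymm hUW fun v hv => hFU ?_
  exact inf_iSup_le_of_iSupIndep (iSupIndep_weightSpace N) hF φ ⟨hv.2, hFW hv.1⟩

/-- Pairwise commuting operators on a nonzero finite-dimensional complex space have a common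
eigenvector. -/
theorem exists_common_eigenvector {ι : Type*} {V : Type*} [AddCommGroup V] [Module ℂ V]
    (n : ℕ) (U : Submodule ℂ V) [FiniteDimensional ℂ U] (hn : Module.finrank ℂ U ≤ n) (hU : U ≠ ⊥)
    (f : ι → Module.End ℂ V)
    (hf : ∀ i, ∀ v ∈ U, f i v ∈ U) (hc : ∀ i j, ∀ v ∈ U, f i (f j v) = f j (f i v)) :
    ∃ v ∈ U, v ≠ 0 ∧ ∃ φ : ι → ℂ, ∀ i, f i v = φ i • v := by
  induction n generalizing U with
  | zero => exact absurd (Submodule.finrank_eq_zero.1 (Nat.le_zero.1 hn)) hU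
  | succ n ih =>
    by_cases h : ∀ i, ∃ c : ℂ, ∀ v ∈ U, f i v = c • v
    · choose c hc using h
      obtain ⟨v, hv, hv0⟩ := U.ne_bot_iff.1 hU
      exact ⟨v, hv, hv0, c, fun i => hc i v hv⟩
    -- A nonscalar operator has an eigenspace that is nonzero and strictly smaller; the other
    -- operators preserve it, and the induction descends to it.
    · push Not at h
      obtain ⟨i, hi⟩ := h
      have : Nontrivial U := Submodule.nontrivial_iff_ne_bot.2 hU
      obtain ⟨c, hcev⟩ := Module.End.exists_eigenvalue ((f i).restrict (hf i))
      obtain ⟨⟨w, hwU⟩, hw⟩ := hcev.exists_hasEigenvector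
      have hw1 : f i w = c • w := congrArg Subtype.val hw.apply_eq_smul
      have hw0 : w ≠ 0 := fun h => hw.2 (Subtype.ext h)
      obtain ⟨u, huU, hu⟩ := hi c
      let U' := U ⊓ Module.End.eigenspace (f i) c
      have hU'U : U' ≤ U := inf_le_left
      have hlt : U' < U := by
        refine lt_of_le_of_ne hU'U fun h => hu ?_
        rw [← h] at huU
        exact Module.End.mem_eigenspace_iff.1 huU.2
      have := Submodule.finiteDimensional_of_le hU'U
      have hlt' := Submodule.finrank_lt_finrank_of_lt hlt
      obtain ⟨v, hv, hv0, hφ⟩ := ih U' (by omega)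
        (U'.ne_bot_iff.2 ⟨w, ⟨hwU, Module.End.mem_eigenspace_iff.2 hw1⟩, hw0⟩)
        (fun j v hv => ⟨hf j v hv.1, by
          refine Module.End.mem_eigenspace_iff.2 ?_
          rw [hc i j v hv.1, Module.End.mem_eigenspace_iff.1 hv.2, map_smul]⟩)
        (fun j k v hv => hc j k v hv.1)
      exact ⟨v, hv.1, hv0, hφ⟩

/-- Only the operators on `U` have to commute: the groups to which this applies are not abelian and
commute only on a chosen eigenspace. -/
theorem exists_weight_vector [FiniteDimensional ℂ V] {N : Subgroup G} {U : Submodule ℂ V}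
    (hU : U ≠ ⊥)
    (hN : IsStable ρ N U)
    (hc : ∀ m ∈ N, ∀ n ∈ N, ∀ v ∈ U, ρ (m * n) v = ρ (n * m) v) :
    ∃ φ : N → ℂ, U ⊓ weightSpace ρ N φ ≠ ⊥ := by
  obtain ⟨v, hv, hv0, φ, hφ⟩ := exists_common_eigenvector _ U le_rfl hU (fun n : N => ρ n)
    (fun n => hN n n.2) (fun m n v hv => by simpa using hc m m.2 n n.2 v hv)
  exact ⟨φ, (Submodule.ne_bot_iff _).2 ⟨v, ⟨hv, mem_weightSpace.2 hφ⟩, hv0⟩⟩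

/-- The weights of a sum of conjugates of weight vectors are conjugates. -/
theorem exists_conj_weight {L N : Subgroup G} {E : Submodule ℂ V}
    (hN : ∀ g ∈ L, ∀ n ∈ N, g⁻¹ * n * g ∈ N) (φ φ' : N → ℂ) (hEφ : E ≤ weightSpace ρ N φ)
    {u : V} (huE : u ∈ orbitSup ρ L E) (hu : u ∈ weightSpace ρ N φ') (hu0 : u ≠ 0) :
    ∃ g : L, ∀ n : N, φ' n = φ ⟨_, hN g g.2 n n.2⟩ := by
  let s : Set (N → ℂ) := {φ'' | ∃ g : L, ∀ n : N, φ'' n = φ ⟨_, hN g g.2 n n.2⟩}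
  by_contra hcon
  have hd : Disjoint (weightSpace ρ N φ') (⨆ i ∈ s, weightSpace ρ N i) :=
    (iSupIndep_weightSpace (ρ := ρ) N).disjoint_biSup hcon
  refine hu0 ((Submodule.disjoint_def.1 hd) u hu ?_)
  have hle : orbitSup ρ L E ≤ ⨆ i ∈ s, weightSpace ρ N i := by
    refine iSup_le fun g => ?_
    obtain ⟨φg, hφg⟩ : ∃ φg : N → ℂ, ∀ n : N, φg n = φ ⟨_, hN g g.2 n n.2⟩ := ⟨_, fun _ => rfl⟩
    have hs : φg ∈ s := ⟨g, hφg⟩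
    rintro _ ⟨v, hv, rfl⟩
    exact Submodule.mem_iSup_of_mem φg (Submodule.mem_iSup_of_mem hs
      (apply_mem_weightSpace (fun n => ⟨⟨_, hN g g.2 n n.2⟩, rfl, hφg n⟩) (hEφ hv)))
  exact hle huE

/-- Clifford theory: a sum of conjugates of a weight space which is irreducible for the stabilizer
of the weight is irreducible. -/
theorem isIrrOn_of_weightSpace [FiniteDimensional ℂ V] {L L' N : Subgroup G} {W E : Submodule ℂ V}
    (hL' : L' ≤ L) (hNL : N ≤ L)
    (hc : ∀ m ∈ N, ∀ n ∈ N, ∀ v ∈ W, ρ (m * n) v = ρ (n * m) v)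
    (hN : ∀ g ∈ L, ∀ n ∈ N, g⁻¹ * n * g ∈ N) (φ : N → ℂ)
    (hE : IsIrrOn ρ L' E) (hEφ : E ≤ weightSpace ρ N φ) (hWE : W ⊓ weightSpace ρ N φ ≤ E)
    (hW : W = orbitSup ρ L E) : IsIrrOn ρ L W := by
  have hEW : E ≤ W := hW ▸ le_orbitSup L E
  refine ⟨fun h => hE.ne_bot (le_bot_iff.1 (h ▸ hEW)), hW ▸ isStable_orbitSup L E,
    fun U hUW hU hUL => ?_⟩
  -- An invariant `U` contains a weight vector; its weight is conjugate to `φ`, so it can be moved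
  -- back into `E`, and irreducibility of `E` forces `E ≤ U`.
  obtain ⟨φ', hφ'⟩ := exists_weight_vector hU (hUL.mono hNL)
    (fun m hm n hn v hv => hc m hm n hn v (hUW hv))
  obtain ⟨u, hu, hu0⟩ := (Submodule.ne_bot_iff _).1 hφ'
  obtain ⟨⟨g, hg⟩, hgφ⟩ := exists_conj_weight hN φ φ' hEφ (hW ▸ hUW hu.1) hu.2 hu0
  have hgu : ρ g⁻¹ u ∈ weightSpace ρ N φ := by
    refine apply_mem_weightSpace (fun n => ?_) hu.2
    have h := hN g⁻¹ (inv_mem hg) n n.2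
    refine ⟨⟨_, h⟩, rfl, ?_⟩
    rw [hgφ]
    congr 1
    ext
    simp [mul_assoc]
  have hguU : ρ g⁻¹ u ∈ U := hUL g⁻¹ (inv_mem hg) u hu.1
  have hEU : U ⊓ E = E := by
    refine hE.eq_of_le _ inf_le_right ?_ ((hUL.mono hL').inf hE.stable)
    refine (Submodule.ne_bot_iff _).2 ⟨_, ⟨hguU, hWE ⟨hUW hguU, hgu⟩⟩, fun h => hu0 ?_⟩
    rw [← apply_apply_inv (ρ := ρ) g u, h, map_zero]
  refine le_antisymm hUW ?_
  rw [hW]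
  exact orbitSup_le (inf_eq_right.1 hEU) hUL

/-- Schur's lemma. -/
theorem IsIrrOn.exists_scalar [FiniteDimensional ℂ V] {L : Subgroup G} {W : Submodule ℂ V}
    (hW : IsIrrOn ρ L W) {g : G} (hg : g ∈ L) (hc : ∀ h ∈ L, ∀ v ∈ W, ρ (g * h) v = ρ (h * g) v) :
    ∃ c : ℂ, ∀ v ∈ W, ρ g v = c • v := by
  obtain ⟨w, hw, hw0, φ, hφ⟩ := exists_common_eigenvector _ W le_rfl hW.ne_bot
    (fun _ : Unit => ρ g) (fun _ => hW.stable g hg) (fun _ _ _ _ => rfl)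
  refine ⟨φ (), fun v hv => ?_⟩
  have := hW.eq_of_le (W ⊓ Module.End.eigenspace (ρ g) (φ ())) inf_le_left
    ((Submodule.ne_bot_iff _).2 ⟨w, ⟨hw, Module.End.mem_eigenspace_iff.2 (hφ ())⟩, hw0⟩)
    fun h hh v hv => ⟨hW.stable h hh v hv.1, by
      refine Module.End.mem_eigenspace_iff.2 ?_
      rw [← Module.End.mul_apply, ← map_mul, hc h hh v hv.1, map_mul,
        Module.End.mul_apply, Module.End.mem_eigenspace_iff.1 hv.2, map_smul]⟩
  rw [← this] at hv
  exact Module.End.mem_eigenspace_iff.1 hv.2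

theorem IsIrrOn.of_le {L L' : Subgroup G} {W : Submodule ℂ V} (hW : IsIrrOn ρ L W)
    (hL : L' ≤ L) (h : ∀ U ≤ W, IsStable ρ L' U → IsStable ρ L U) : IsIrrOn ρ L' W :=
  ⟨hW.ne_bot, hW.stable.mono hL, fun U hU hU0 hUL => hW.eq_of_le U hU hU0 (h U hU hUL)⟩

/-- An irreducible space on which the group acts through commuting operators has no proper
nonzero subspace. -/
theorem IsIrrOn.of_commute [FiniteDimensional ℂ V] {L : Subgroup G} {W : Submodule ℂ V}
    (hW : IsIrrOn ρ L W)
    (hc : ∀ g ∈ L, ∀ h ∈ L, ∀ v ∈ W, ρ (g * h) v = ρ (h * g) v) {L' : Subgroup G} (hL' : L' ≤ L) :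
    IsIrrOn ρ L' W := by
  refine hW.of_le hL' fun U hU _ g hg v hv => ?_
  obtain ⟨c, hgc⟩ := hW.exists_scalar hg (hc g hg)
  rw [hgc v (hU hv)]
  exact U.smul_mem c hv

theorem IsIrrOn.map {L : Subgroup G} [L.Normal] {W : Submodule ℂ V} (hW : IsIrrOn ρ L W) (g : G) :
    IsIrrOn ρ L (W.map (ρ g)) := by
  have key : ∀ (g : G) (U : Submodule ℂ V), IsStable ρ L U → IsStable ρ L (U.map (ρ g)) := by
    rintro g U hU h hh _ ⟨v, hv, rfl⟩
    refine ⟨ρ (g⁻¹ * h * g) v, hU _ ?_ v hv, ?_⟩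
    · simpa using Subgroup.Normal.conj_mem ‹_› h hh g⁻¹
    · rw [← Module.End.mul_apply, ← map_mul, ← Module.End.mul_apply, ← map_mul]
      congr 2
      group
  have inv : ∀ (g : G) (U : Submodule ℂ V), (U.map (ρ g⁻¹)).map (ρ g) = U := by
    intro g U
    rw [← Submodule.map_comp, ← Module.End.mul_eq_comp, ← map_mul]
    simp [Module.End.one_eq_id]
  have inv' : ∀ (g : G) (U : Submodule ℂ V), (U.map (ρ g)).map (ρ g⁻¹) = U := by
    intro g U
    simpa using inv g⁻¹ U
  refine ⟨fun h => hW.ne_bot ?_, key g W hW.stable, fun U hU hU0 hUL => ?_⟩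
  · rw [← inv' g W, h, Submodule.map_bot]
  · rw [← inv g U, hW.eq_of_le (U.map (ρ g⁻¹))]
    · rw [← inv' g W]
      exact Submodule.map_mono hU
    · intro h
      rw [← inv g U, h, Submodule.map_bot] at hU0
      exact hU0 rfl
    · exact key _ _ hUL

end Clifford
end SL2Branching
end

noncomputable section
namespace SL2Branching

/-! ### Restriction of an irreducible representation to a normal subgroup. -/

section Clifford

variable {G V : Type*} [Group G] [AddCommGroup V] [Module ℂ V] {ρ : Representation ℂ G V}

/-- Clifford theory for the restriction to a normal subgroup `H`: an irreducible representation is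
a direct sum of translates of the `H`-module generated by a weight space, provided that this
`H`-module is irreducible. -/
theorem exists_isInternal_of_weightSpace [FiniteDimensional ℂ V] (hρ : IsIrrOn ρ ⊤ ⊤)
    {N I H D : Subgroup G} [H.Normal] [D.FiniteIndex] (hN : ∀ g : G, ∀ n ∈ N, g⁻¹ * n * g ∈ N)
    (φ : N → ℂ)
    (hI : ∀ g, (∀ n : N, φ ⟨g⁻¹ * n * g, hN g n n.2⟩ = φ n) → g ∈ I)
    (hI' : IsStable ρ I (weightSpace ρ N φ))
    (hH : IsIrrOn ρ H (orbitSup ρ H (weightSpace ρ N φ)))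
    (hne : weightSpace ρ N φ ≠ ⊥)
    (hHD : H ≤ D) (hID : I ≤ D) (hD : ∀ g ∈ D, ∃ h ∈ H, ∃ i ∈ I, g = h * i) :
    ∃ W : G ⧸ D → Submodule ℂ V, iSupIndep W ∧ iSup W = ⊤ ∧
      ∀ x, IsIrrOn ρ H (W x) ∧ Module.finrank ℂ (W x) * D.index = Module.finrank ℂ V := by
  set E := weightSpace ρ N φ with hE
  let W : G ⧸ D → Submodule ℂ V := fun x => (orbitSup ρ H E).map (ρ x.out)
  -- These are the only weights that can occur in `W x`. As `D` contains the stabilizer of `φ`,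
  -- distinct cosets have disjoint weight sets, which makes the translates independent.
  let s : G ⧸ D → Set (N → ℂ) := fun x =>
    {φ' | ∃ g : G, (g : G ⧸ D) = x ∧ ∀ n : N, φ' n = φ ⟨g⁻¹ * n * g, hN g n n.2⟩}
  have hWs : ∀ x, W x ≤ ⨆ φ' ∈ s x, weightSpace ρ N φ' := by
    intro x
    rw [Submodule.map_le_iff_le_comap]
    refine iSup_le fun h => ?_
    rintro _ ⟨v, hv, rfl⟩
    obtain ⟨g, hg⟩ : ∃ g, g = x.out * h := ⟨_, rfl⟩
    obtain ⟨φg, hφg⟩ : ∃ φg : N → ℂ, ∀ n : N, φg n = φ ⟨g⁻¹ * n * g, hN g n n.2⟩ :=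
      ⟨_, fun _ => rfl⟩
    have hs : φg ∈ s x := by
      refine ⟨g, ?_, hφg⟩
      rw [hg, QuotientGroup.mk_mul_of_mem _ (hHD h.2), QuotientGroup.out_eq']
    have hgv : ρ x.out (ρ h v) = ρ g v := by rw [hg, map_mul, Module.End.mul_apply]
    rw [Submodule.mem_comap, hgv]
    exact Submodule.mem_iSup_of_mem φg (Submodule.mem_iSup_of_mem hs
      (apply_mem_weightSpace (fun n => ⟨⟨_, hN g n n.2⟩, rfl, hφg n⟩) hv))
  have hss : ∀ x y, x ≠ y → Disjoint (s x) (s y) := by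
    intro x y hxy
    rw [Set.disjoint_left]
    rintro φ' ⟨g, rfl, hg⟩ ⟨g', rfl, hg'⟩
    refine hxy (QuotientGroup.eq.2 (hID (hI _ fun n => ?_)))
    have h1 := hg ⟨g * n * g⁻¹, by simpa using hN g⁻¹ n n.2⟩
    rw [hg'] at h1
    convert h1 using 3 <;> simp [mul_assoc]
  have hindep : iSupIndep W := by
    intro x
    refine ((iSupIndep_weightSpace (ρ := ρ) N).disjoint_biSup_biSup (s := s x)
      (t := ⋃ y ∈ {y | y ≠ x}, s y) ?_).mono (hWs x) ?_
    · rw [Set.disjoint_iUnion₂_right]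
      exact fun y hy => hss x y (Ne.symm hy)
    · refine iSup₂_le fun y hy => (hWs y).trans ?_
      exact biSup_mono fun φ' hφ' => Set.mem_biUnion (show y ∈ {y | y ≠ x} from hy) hφ'
  have htop : iSup W = ⊤ := by
    rw [eq_top_iff, ← hρ.orbitSup_eq (U := E) le_top hne]
    refine iSup_le fun g => ?_
    obtain ⟨h, hh, i, hi, hhi⟩ := hD ((((g : G) : G ⧸ D).out)⁻¹ * g) (by
      rw [← QuotientGroup.eq, QuotientGroup.out_eq'])
    rintro _ ⟨v, hv, rfl⟩
    refine Submodule.mem_iSup_of_mem ((g : G) : G ⧸ D) ⟨ρ h (ρ i v), ?_, ?_⟩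
    · exact isStable_orbitSup H E h hh _ (le_orbitSup H E (hI' i hi v hv))
    · simp only [← Module.End.mul_apply, ← map_mul]
      rw [← hhi, mul_inv_cancel_left]
  classical
  have hint : DirectSum.IsInternal W :=
    (DirectSum.isInternal_submodule_iff_iSupIndep_and_iSup_eq_top W).2 ⟨hindep, htop⟩
  have hfin : ∀ x, Module.finrank ℂ (W x) = Module.finrank ℂ (orbitSup ρ H E) := fun x =>
    ((orbitSup ρ H E).equivMapOfInjective (ρ x.out) fun v w hvw => by
      rw [← apply_inv_apply (ρ := ρ) x.out v, hvw, apply_inv_apply]).finrank_eq.symm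
  have := D.fintypeQuotientOfFiniteIndex
  refine ⟨W, hindep, htop, fun x => ⟨hH.map _, ?_⟩⟩
  rw [← (LinearEquiv.ofBijective (DirectSum.coeLinearMap W) hint).finrank_eq,
    Module.finrank_directSum, Finset.sum_congr rfl fun y _ => (hfin y).trans (hfin x).symm,
    Finset.sum_const, smul_eq_mul, mul_comm, Finset.card_univ, Subgroup.index,
    Nat.card_eq_fintype_card]

end Clifford

/-! ### Constituents of an induced character. -/

section Induced

variable {G : Type*} [Group G] {N : Subgroup G} (χ : N →* ℂ)

/-- The element `n` sends the generator at `g` to the one at `g * n⁻¹` = (g n⁻¹ g⁻¹) g, and the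
coinvariants relation trades the left factor for a value of `χ`. -/
theorem ind_mk_mem_weightSpace (hN : ∀ g : G, ∀ n ∈ N, g⁻¹ * n * g ∈ N) (g : G) (a : ℂ) :
    Representation.IndV.mk N.subtype (charRep χ) g a ∈
      weightSpace (Representation.ind N.subtype (charRep χ)) N
        (fun n => χ ⟨g * n * g⁻¹, by simpa using hN g⁻¹ n n.2⟩) := by
  rw [mem_weightSpace]
  intro n
  rw [Representation.ind_mk]
  have h := Representation.Coinvariants.mk_self_apply
    (Representation.tprod ((Representation.leftRegular ℂ G).comp N.subtype) (charRep χ))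
    ⟨g * n * g⁻¹, by simpa using hN g⁻¹ n n.2⟩
    (TensorProduct.tmul ℂ (MonoidAlgebra.single (g * (n : G)⁻¹) 1) a)
  simp only [Representation.IndV.mk, LinearMap.comp_apply, TensorProduct.mk_apply]
  rw [← h, ← map_smul]
  congr 1
  have ha : ∀ m : N, (charRep χ) m a = χ m • a := fun m => rfl
  simp [ha]
  rw [← smul_eq_mul, TensorProduct.tmul_smul]

/-- All weights of the induced representation are conjugates of `χ`, because it is generated by a
`χ`-eigenspace. Hence any weight vector of `ρ` is carried to weight `χ` by some group element. -/
theorem IsIrrOver.weightSpace_ne_bot {V : Type*} [AddCommGroup V] [Module ℂ V]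
    [FiniteDimensional ℂ V] {ρ : Representation ℂ G V}
    (hN : ∀ g : G, ∀ n ∈ N, g⁻¹ * n * g ∈ N) (hρ : IsIrrOver (charRep χ) ρ) :
    weightSpace ρ N χ ≠ ⊥ := by
  obtain ⟨hirr, f, hf⟩ := hρ
  let T := Representation.ind N.subtype (charRep χ)
  have hcomm : ∀ (m n : N) x, T (m * n) x = T (n * m) x := by
    intro m n x
    refine LinearMap.congr_fun ?_ x
    refine Representation.IndV.hom_ext _ _ fun g => LinearMap.ext fun a => ?_
    have h := mem_weightSpace.1 (ind_mk_mem_weightSpace χ hN g a)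
    have h2 : ∀ m n : N, T (m * n) (Representation.IndV.mk N.subtype (charRep χ) g a) =
        (χ ⟨g * n * g⁻¹, by simpa using hN g⁻¹ n n.2⟩ *
          χ ⟨g * m * g⁻¹, by simpa using hN g⁻¹ m m.2⟩) •
            (Representation.IndV.mk N.subtype (charRep χ) g a) := fun m n => by
      rw [map_mul, Module.End.mul_apply, h n, map_smul, h m, smul_smul]
    change T (m * n) (Representation.IndV.mk N.subtype (charRep χ) g a) =
      T (n * m) (Representation.IndV.mk N.subtype (charRep χ) g a)
    rw [h2, h2, mul_comm]
  have hV : (⊤ : Submodule ℂ V) ≠ ⊥ := by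
    intro h
    obtain ⟨⟨a, b, hab⟩⟩ := hirr.toNontrivial
    refine hab (Subrepresentation.toSubmodule_injective ?_)
    have := (Submodule.subsingleton_iff ℂ).1 (subsingleton_of_bot_eq_top h.symm)
    exact Subsingleton.elim _ _
  have hfρ : ∀ g v, f (ρ g v) = T g (f v) := fun g v => LinearMap.congr_fun (f.isIntertwining' g) v
  obtain ⟨φ', hφ'⟩ := exists_weight_vector (ρ := ρ) (N := N) hV (fun _ _ _ _ => trivial)
    (fun m hm n hn v _ => hf (by rw [hfρ, hfρ]; exact hcomm ⟨m, hm⟩ ⟨n, hn⟩ _))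
  obtain ⟨v, ⟨-, hv⟩, hv0⟩ := (Submodule.ne_bot_iff _).1 hφ'
  let E : Submodule ℂ (Representation.IndV N.subtype (charRep χ)) :=
    LinearMap.range (Representation.IndV.mk N.subtype (charRep χ) 1)
  have hE : E ≤ weightSpace T N χ := by
    rintro _ ⟨a, rfl⟩
    simpa using ind_mk_mem_weightSpace χ hN 1 a
  have htop : orbitSup T ⊤ E = ⊤ := by
    rw [← Submodule.ker_mkQ (orbitSup T ⊤ E), LinearMap.ker_eq_top]
    refine Representation.IndV.hom_ext _ _ fun g => LinearMap.ext fun a => ?_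
    simp only [LinearMap.comp_apply, LinearMap.zero_apply, Submodule.mkQ_apply,
      Submodule.Quotient.mk_eq_zero]
    refine Submodule.mem_iSup_of_mem ⟨g⁻¹, trivial⟩
      ⟨Representation.IndV.mk N.subtype (charRep χ) 1 a, ⟨a, rfl⟩, ?_⟩
    refine (Representation.ind_mk N.subtype (charRep χ) g⁻¹ 1 a).trans ?_
    rw [one_mul, inv_inv, LinearMap.comp_apply]
  have hfv : f v ∈ weightSpace T N φ' := by
    refine mem_weightSpace.2 fun n => ?_
    rw [← hfρ, mem_weightSpace.1 hv, map_smul]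
  obtain ⟨g, hg⟩ := exists_conj_weight (fun g _ => hN g) χ φ' hE (u := f v)
    (by rw [htop]; trivial) hfv
    (fun h => hv0 (hf (by rw [h, map_zero])))
  refine (Submodule.ne_bot_iff _).2 ⟨ρ (g : G)⁻¹ v, apply_mem_weightSpace (fun n => ?_) hv,
    fun h => hv0 ?_⟩
  · refine ⟨⟨_, hN (g : G)⁻¹ n n.2⟩, rfl, ?_⟩
    rw [hg]
    congr 1
    ext
    simp [mul_assoc]
  · rw [← apply_apply_inv (ρ := ρ) g v, h, map_zero]

theorem IsIrrOver.isIrrOn_top {V : Type*} [AddCommGroup V] [Module ℂ V]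
    {ρ : Representation ℂ G V} (hρ : ρ.IsIrreducible) : IsIrrOn ρ ⊤ ⊤ := by
  refine ⟨fun h => ?_, fun _ _ _ _ => trivial, fun U _ hU hUG => ?_⟩
  · obtain ⟨⟨a, b, hab⟩⟩ := hρ.toNontrivial
    refine hab (Subrepresentation.toSubmodule_injective ?_)
    have := (Submodule.subsingleton_iff ℂ).1 (subsingleton_of_bot_eq_top h.symm)
    exact Subsingleton.elim _ _
  · let U' : Subrepresentation ρ := ⟨U, fun g => hUG g trivial⟩
    rcases hρ.eq_bot_or_eq_top U' with h | h
    · exact absurd (congrArg Subrepresentation.toSubmodule h) hU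
    · exact congrArg Subrepresentation.toSubmodule h

end Induced

/-! ### From irreducibility on a subspace to irreducible subrepresentations. -/

section Restriction

variable {G V : Type*} [Group G] [AddCommGroup V] [Module ℂ V]

theorem IsIrrOn.isIrreducible {ρ : Representation ℂ G V} (h : IsIrrOn ρ ⊤ ⊤) :
    ρ.IsIrreducible where
  exists_pair_ne := ⟨⊥, ⊤, fun he => h.ne_bot (congrArg Subrepresentation.toSubmodule he).symm⟩
  eq_bot_or_eq_top U := by
    by_cases hU : U.toSubmodule = ⊥
    · exact Or.inl (Subrepresentation.toSubmodule_injective hU)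
    · exact Or.inr (Subrepresentation.toSubmodule_injective
        (h.eq_of_le _ le_top hU fun g _ => U.apply_mem_toSubmodule g))

theorem IsIrrOn.toRepresentation_isIrreducible {ρ : Representation ℂ G V} {W : Subrepresentation ρ}
    (h : IsIrrOn ρ ⊤ W.toSubmodule) : W.toRepresentation.IsIrreducible := by
  refine IsIrrOn.isIrreducible ⟨fun he => h.ne_bot ?_, fun _ _ _ _ => trivial,
    fun U _ hU hUG => ?_⟩
  · have := subsingleton_of_bot_eq_top he.symm
    have := (Submodule.subsingleton_iff ℂ).1 this
    exact Submodule.subsingleton_iff_eq_bot.1 this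
  · have hmap := h.eq_of_le (U.map W.toSubmodule.subtype) (Submodule.map_subtype_le _ _)
      (fun hb => hU
        (Submodule.map_injective_of_injective (Submodule.injective_subtype _)
          (hb.trans (Submodule.map_bot _).symm)))
      (by
        rintro g - _ ⟨v, hv, rfl⟩
        exact ⟨_, hUG g trivial v hv, rfl⟩)
    refine eq_top_iff.2 fun w _ => ?_
    obtain ⟨u, hu, huw⟩ : (w : V) ∈ U.map W.toSubmodule.subtype := by
      rw [hmap]; exact w.2
    rwa [← Subtype.ext huw]

end Restriction
end SL2Branching
end

noncomputable section
namespace SL2Branching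

/-! ### Finite chain rings: annihilators, primitive characters, squares. -/

section ChainRing

variable {R : Type*} [CommRing R] [IsLocalRing R]

/-- `R` is a local ring whose maximal ideal is generated by `ϖ`, with `ϖ ^ r = 0`. -/
structure IsChainRing (ϖ : R) (r : ℕ) : Prop where
  maximalIdeal_eq : maximalIdeal R = Ideal.span {ϖ}
  pow_eq_zero : ϖ ^ r = 0

variable {ϖ : R} {r : ℕ}

theorem IsChainRing.residue_eq_zero_iff (h : IsChainRing ϖ r) {x : R} :
    residue R x = 0 ↔ ϖ ∣ x := by
  rw [IsLocalRing.residue_eq_zero_iff, h.maximalIdeal_eq, Ideal.mem_span_singleton]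

theorem IsChainRing.pow_eq_zero_of_le (h : IsChainRing ϖ r) {n : ℕ} (hn : r ≤ n) : ϖ ^ n = 0 :=
  _root_.pow_eq_zero_of_le hn h.pow_eq_zero

theorem IsChainRing.exists_eq_unit_mul_pow (h : IsChainRing ϖ r) {x : R} (hx : x ≠ 0) :
    ∃ k < r, ∃ u : Rˣ, x = u * ϖ ^ k := by
  by_contra! hcon
  have key : ∀ k ≤ r, ϖ ^ k ∣ x := by
    intro k
    induction k with
    | zero => simp
    | succ k ih =>
      intro hk
      obtain ⟨y, rfl⟩ := ih (by omega)
      have hy : ¬ IsUnit y := by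
        rintro ⟨u, rfl⟩
        exact hcon k (by omega) u (mul_comm _ _)
      have hy' : y ∈ Ideal.span {ϖ} := h.maximalIdeal_eq ▸ (mem_maximalIdeal y).2 hy
      obtain ⟨z, rfl⟩ := Ideal.mem_span_singleton.1 hy'
      exact ⟨z, by ring⟩
  obtain ⟨y, rfl⟩ := key r le_rfl
  exact hx (by rw [h.pow_eq_zero, zero_mul])

theorem IsChainRing.exists_mul_eq (h : IsChainRing ϖ r) {x : R} (hx : x ≠ 0) :
    ∃ y, x * y = ϖ ^ (r - 1) := by
  obtain ⟨k, hk, u, rfl⟩ := h.exists_eq_unit_mul_pow hx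
  refine ⟨(u⁻¹ : Rˣ) * ϖ ^ (r - 1 - k), ?_⟩
  rw [mul_mul_mul_comm, Units.mul_inv, one_mul, ← pow_add]
  congr 1
  omega

/-- An additive character which is nontrivial on the socle of `R` is primitive. -/
theorem IsChainRing.eq_zero_of_addChar (h : IsChainRing ϖ r) {ψ : AddChar R ℂ}
    (hψ : ψ (ϖ ^ (r - 1)) ≠ 1) {x : R} (hx : ∀ y, ψ (x * y) = 1) : x = 0 := by
  by_contra hx0
  obtain ⟨y, hy⟩ := h.exists_mul_eq hx0
  exact hψ (hy ▸ hx y)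

/-- The condition `ϖ ^ (r - 1) ≠ 0` makes the length of the ring exactly `r`, so that the valuation
of a nonzero element is determined by its annihilator. -/
theorem IsChainRing.dvd_of_pow_mul_eq_zero (h : IsChainRing ϖ r) (h0 : ϖ ^ (r - 1) ≠ 0) {a : ℕ}
    (ha : a ≤ r) {x : R} (hx : ϖ ^ a * x = 0) : ϖ ^ (r - a) ∣ x := by
  by_cases hx0 : x = 0
  · rw [hx0]; exact dvd_zero _
  obtain ⟨k, hk, u, rfl⟩ := h.exists_eq_unit_mul_pow hx0
  by_cases hak : a + k ≤ r - 1
  · refine absurd ?_ h0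
    have h1 : ϖ ^ (a + k) = 0 := by
      have := congrArg (fun t => ((u⁻¹ : Rˣ) : R) * t) hx
      rwa [mul_zero, mul_left_comm, ← mul_assoc (u⁻¹ : Rˣ).1, Units.inv_mul, one_mul,
        ← pow_add] at this
    exact _root_.pow_eq_zero_of_le hak h1
  · exact (pow_dvd_pow ϖ (by omega)).mul_left _

theorem IsChainRing.residue_eq_zero_of_mul (h : IsChainRing ϖ r) (h0 : ϖ ^ (r - 1) ≠ 0)
    {x : R} (hx : ϖ ^ (r - 1) * x = 0) : residue R x = 0 := by
  rcases Nat.eq_zero_or_pos r with rfl | hr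
  · exact absurd h.pow_eq_zero h0
  rw [h.residue_eq_zero_iff]
  simpa [Nat.sub_sub_self (Nat.one_le_iff_ne_zero.2 hr.ne')] using
    h.dvd_of_pow_mul_eq_zero h0 (Nat.sub_le r 1) hx

theorem IsChainRing.mul_eq_zero_of_residue (h : IsChainRing ϖ r) {n : ℕ} (hn : r ≤ n + 1) {x : R}
    (hx : residue R x = 0) : ϖ ^ n * x = 0 := by
  obtain ⟨y, rfl⟩ := h.residue_eq_zero_iff.1 hx
  rw [← mul_assoc, ← pow_succ, h.pow_eq_zero_of_le hn, zero_mul]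

/-- Every additive character of `R` is a translate of a given primitive one. -/
theorem IsChainRing.exists_addChar_eq [Finite R] (h : IsChainRing ϖ r) {ψ : AddChar R ℂ}
    (hψ : ψ (ϖ ^ (r - 1)) ≠ 1) (θ : AddChar R ℂ) : ∃ y, ∀ z, θ z = ψ (y * z) := by
  have := Fintype.ofFinite R
  have hinj : Function.Injective (fun y => ψ.mulShift y) := by
    intro y y' hyy
    rw [← sub_eq_zero]
    refine h.eq_zero_of_addChar hψ fun z => ?_
    have := DFunLike.congr_fun hyy z
    simp only [AddChar.mulShift_apply] at this
    have hne : ψ (y' * z) ≠ 0 := (ψ.val_isUnit _).ne_zero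
    rw [sub_mul, AddChar.map_sub_eq_div, this, div_self hne]
  have hbij := (Fintype.bijective_iff_injective_and_card _).2 ⟨hinj, AddChar.card_eq.symm⟩
  obtain ⟨y, rfl⟩ := hbij.2 θ
  exact ⟨y, fun z => AddChar.mulShift_apply⟩

/-- Hensel's lemma for a quadratic polynomial whose linear coefficient is a unit. -/
theorem exists_quadratic_root [Finite R] {t : R} (ht : IsUnit t) (d : R) {c : R}
    (hc : c ∈ maximalIdeal R) : ∃ b ∈ maximalIdeal R, t * b + d * b ^ 2 = c := by
  -- The polynomial maps the finite maximal ideal to itself; differences factor through `t + d * (b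
  -- + b')`, a unit, so it is injective and therefore onto.
  let f : maximalIdeal R → maximalIdeal R := fun b =>
    ⟨t * b + d * b ^ 2, Ideal.add_mem _ (Ideal.mul_mem_left _ _ b.2)
      (Ideal.mul_mem_left _ _ (Ideal.pow_mem_of_mem _ b.2 2 two_pos))⟩
  have hf : Function.Injective f := by
    rintro ⟨b, hb⟩ ⟨b', hb'⟩ hbb
    have hbb : t * b + d * b ^ 2 = t * b' + d * b' ^ 2 := congrArg Subtype.val hbb
    have hu : IsUnit (t + d * (b + b')) := by
      by_contra hn
      refine (mem_maximalIdeal t).1 ?_ ht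
      have := Ideal.sub_mem _ ((mem_maximalIdeal _).2 hn)
        (Ideal.mul_mem_left _ d (Ideal.add_mem _ hb hb'))
      simpa using this
    have h0 : (t + d * (b + b')) * (b - b') = 0 := by linear_combination hbb
    exact Subtype.ext (sub_eq_zero.1 ((hu.mul_right_eq_zero).1 h0))
  obtain ⟨b, hb⟩ := Finite.surjective_of_injective hf ⟨c, hc⟩
  exact ⟨b, b.2, congrArg Subtype.val hb⟩

/-- A root is sought as 1 + 2b, whose square is 1 + 4(b + b²) with 4 = u²ϖ^(2e). The extra factor
`ϖ` allowed by n ≥ 2e + 1 places the required value of b + b² in the maximal ideal, where Hensel's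
lemma applies. -/
theorem IsChainRing.isSquare_one_add [Finite R] (h : IsChainRing ϖ r) {e : ℕ} {u : Rˣ}
    (he : (2 : R) = u * ϖ ^ e) {n : ℕ} (hn : 2 * e + 1 ≤ n) (y : R) :
    IsSquare (1 + ϖ ^ n * y) := by
  obtain ⟨k, rfl⟩ := Nat.exists_eq_add_of_le hn
  have hϖ : ϖ ∈ maximalIdeal R := h.maximalIdeal_eq ▸ Ideal.mem_span_singleton_self ϖ
  obtain ⟨b, -, hb⟩ := exists_quadratic_root (isUnit_one (M := R)) 1
    (c := ϖ * (ϖ ^ k * (((u⁻¹ : Rˣ) : R) ^ 2 * y))) (Ideal.mul_mem_right _ _ hϖ)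
  refine ⟨1 + 2 * b, ?_⟩
  have h1 : (u : R) ^ 2 * ((u⁻¹ : Rˣ) : R) ^ 2 = 1 := by rw [← mul_pow, Units.mul_inv, one_pow]
  have h4 : (1 + 2 * b) * (1 + 2 * b) = 1 + 2 ^ 2 * (1 * b + 1 * b ^ 2) := by ring
  rw [h4, hb, he]
  have h5 : ϖ ^ (2 * e + 1 + k) = (ϖ ^ e) ^ 2 * ϖ * ϖ ^ k := by ring
  rw [h5]
  linear_combination (-(ϖ ^ e) ^ 2 * ϖ * ϖ ^ k * y) * h1

end ChainRing

/-! ### The trace form and nilpotent 2 × 2 matrices. -/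

section Nilpotent

variable {F : Type*} [Field F] {n : Matrix (Fin 2) (Fin 2) F}

open Matrix

theorem mul_self_fin_two {R : Type*} [CommRing R] (A : Matrix (Fin 2) (Fin 2) R) :
    A * A = A.trace • A - A.det • 1 := by
  ext i j
  fin_cases i <;> fin_cases j <;>
    simp [Matrix.mul_apply, Fin.sum_univ_two, trace_fin_two, det_fin_two] <;> ring

/-- This is Cayley–Hamilton for AB with a factor B cancelled. For a nilpotent n it gives nXn =
tr(nX) n. -/
theorem mul_mul_fin_two {R : Type*} [CommRing R] (A B : Matrix (Fin 2) (Fin 2) R) :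
    A * B * A = (A * B).trace • A - A.det • B.adjugate := by
  ext i j
  fin_cases i <;> fin_cases j <;>
    simp [Matrix.mul_apply, Fin.sum_univ_two, trace_fin_two, det_fin_two, adjugate_fin_two] <;> ring

theorem exists_trace_mul_eq_one (hn : n ≠ 0) : ∃ X, (n * X).trace = 1 := by
  obtain ⟨i, j, hij⟩ : ∃ i j, n i j ≠ 0 := by
    by_contra! h
    exact hn (Matrix.ext h)
  refine ⟨Matrix.single j i (n i j)⁻¹, ?_⟩
  rw [Matrix.trace_mul_comm, Matrix.trace_single_mul]
  simp [hij]

theorem trace_eq_zero_of_mul_self (hnn : n * n = 0) : n.trace = 0 := by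
  have h : IsNilpotent n := ⟨2, by rw [pow_two, hnn]⟩
  exact (Matrix.isNilpotent_trace_of_isNilpotent h).eq_zero

theorem det_eq_zero_of_mul_self (hnn : n * n = 0) : n.det = 0 := by
  have := congrArg Matrix.det hnn
  rw [det_mul, det_zero] at this
  exact mul_self_eq_zero.1 this

/-- Write n = x yᵗ with yᵗx = 0. Then tr(nB) = yᵗBx = 0 says that B preserves the line of x, and
likewise that of yᵗ, so Bn and nB are both multiples of n. -/
theorem commutator_of_trace_eq_zero (hn : n ≠ 0) (hnn : n * n = 0)
    {B : Matrix (Fin 2) (Fin 2) F} (hB : (n * B).trace = 0) : ∃ z : F, B * n - n * B = z • n := by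
  have ht := trace_eq_zero_of_mul_self hnn
  have hd := det_eq_zero_of_mul_self hnn
  rw [trace_fin_two] at ht
  have h11 : n 1 1 = - n 0 0 := by linear_combination ht
  rw [det_fin_two, h11] at hd
  simp only [trace_fin_two, Matrix.mul_apply, Fin.sum_univ_two, h11] at hB
  by_cases hb : n 0 1 = 0
  · have ha : n 0 0 = 0 := by
      rw [hb] at hd
      exact mul_self_eq_zero.1 (by linear_combination -hd)
    have hc : n 1 0 ≠ 0 := by
      intro hc
      refine hn (Matrix.ext fun i j => ?_)
      fin_cases i <;> fin_cases j <;> simp [ha, hb, hc, h11]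
    have hB12 : B 0 1 = 0 := by
      rw [ha, hb] at hB
      exact (mul_eq_zero.1 (show n 1 0 * B 0 1 = 0 by linear_combination hB)).resolve_left hc
    refine ⟨B 1 1 - B 0 0, Matrix.ext fun i j => ?_⟩
    fin_cases i <;> fin_cases j <;>
      simp [Matrix.mul_apply, Fin.sum_univ_two, ha, hb, h11, hB12] <;> ring
  · refine ⟨B 0 0 - B 1 1 - 2 * n 0 0 * B 0 1 / n 0 1, Matrix.ext fun i j => ?_⟩
    fin_cases i <;> fin_cases j <;>
      simp [Matrix.mul_apply, Fin.sum_univ_two, h11] <;> field_simp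
    · linear_combination (-n 0 1) * hB - 2 * B 0 1 * hd
    · ring
    · linear_combination 2 * n 0 0 * hB - 2 * (B 1 1 - B 0 0) * hd
    · linear_combination (n 0 1) * hB + 2 * B 0 1 * hd

/-- Thus n^⊥ is isotropic for the alternating form tr(n[B, B']): this equals −tr([B, n]B'), and [B,
n] is a multiple of n. -/
theorem trace_mul_commutator (hn : n ≠ 0) (hnn : n * n = 0)
    {B B' : Matrix (Fin 2) (Fin 2) F} (hB : (n * B).trace = 0) (hB' : (n * B').trace = 0) :
    (n * (B * B' - B' * B)).trace = 0 := by
  obtain ⟨z, hz⟩ := commutator_of_trace_eq_zero hn hnn hB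
  have h : (n * (B * B' - B' * B)).trace = -((B * n - n * B) * B').trace := by
    simp only [mul_sub, sub_mul, trace_sub]
    rw [← mul_assoc, ← mul_assoc, Matrix.trace_mul_comm (n * B') B, mul_assoc B n B']
    ring
  rw [h, hz, smul_mul_assoc, trace_smul, hB', smul_zero, neg_zero]

end Nilpotent
end SL2Branching
end

noncomputable section
namespace SL2Branching

open Matrix

/-! ### Commutators of matrices close to the identity. -/

section Units

variable {R 𝒜 : Type*} [CommRing R] [Ring 𝒜] [Algebra R 𝒜]

theorem commutator_eq_one_add_smul {p p' : 𝒜ˣ} {x : R} {B B' : 𝒜} (hx : x ^ 3 = 0)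
    (hp : (p : 𝒜) = 1 + x • B) (hp' : (p' : 𝒜) = 1 + x • B') :
    (((p' * p)⁻¹ * (p * p') : 𝒜ˣ) : 𝒜) = 1 + x ^ 2 • (B * B' - B' * B) := by
  rw [Units.val_mul, Units.inv_mul_eq_iff_eq_mul, Units.val_mul, Units.val_mul]
  have e : (p' : 𝒜) * p = 1 + x • (B' + B + x • (B' * B)) := by
    rw [hp, hp']
    simp only [mul_add, add_mul, smul_mul_assoc, mul_smul_comm, one_mul, mul_one]
    module
  have h3 : x ^ 2 * x = 0 := by rw [← pow_succ, hx]
  have e2 : (p : 𝒜) * p' = p' * p + x ^ 2 • (B * B' - B' * B) := by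
    rw [hp, hp']
    simp only [mul_add, add_mul, smul_mul_assoc, mul_smul_comm, one_mul, mul_one]
    module
  generalize B' + B + x • (B' * B) = E at e
  rw [e2, mul_add, mul_one, mul_smul_comm, e, add_mul, one_mul, smul_mul_assoc, smul_add,
    smul_smul, h3, zero_smul, add_zero]

theorem inv_mul_eq_sub {p : 𝒜ˣ} {x : R} {B : 𝒜} (hp : (p : 𝒜) = 1 + x • B) (C : 𝒜) :
    ((p⁻¹ : 𝒜ˣ) : 𝒜) * C = C - x • (((p⁻¹ : 𝒜ˣ) : 𝒜) * (B * C)) := by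
  have h : ((p⁻¹ : 𝒜ˣ) : 𝒜) * ((p : 𝒜) * C) = C := Units.inv_mul_cancel_left p C
  rw [hp, add_mul, one_mul, mul_add, smul_mul_assoc, mul_smul_comm] at h
  exact eq_sub_of_add_eq h

theorem conj_eq_one_add_smul {p : 𝒜ˣ} {x : R} {B : 𝒜} (hp : (p : 𝒜) = 1 + x • B) (g : 𝒜ˣ) :
    ((g⁻¹ * p * g : 𝒜ˣ) : 𝒜) = 1 + x • (((g⁻¹ : 𝒜ˣ) : 𝒜) * B * g) := by
  rw [Units.val_mul, Units.val_mul, hp, mul_add, mul_one, add_mul, Units.inv_mul, mul_smul_comm,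
    smul_mul_assoc]

theorem commutator_eq_one_add_smul_inv_mul {p : 𝒜ˣ} {x : R} {B : 𝒜}
    (hp : (p : 𝒜) = 1 + x • B) (c : 𝒜ˣ) :
    (((c * p)⁻¹ * (p * c) : 𝒜ˣ) : 𝒜) =
      1 + x • (((p⁻¹ : 𝒜ˣ) : 𝒜) * (((c⁻¹ : 𝒜ˣ) : 𝒜) * B * c - B)) := by
  have h : (c * p)⁻¹ * (p * c) = p⁻¹ * (c⁻¹ * p * c) := by group
  have h1 : ((p⁻¹ : 𝒜ˣ) : 𝒜) * (1 + x • B) = 1 := hp ▸ p.inv_mul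
  rw [h, Units.val_mul, conj_eq_one_add_smul hp, mul_sub, smul_sub]
  rw [mul_add, mul_one, mul_smul_comm] at h1 ⊢
  rw [← h1]
  abel

end Units

section Commutator

variable {R : Type*} [CommRing R]

/-- The first-order term vanishes since conjugation by an element commuting with `A` preserves the
trace against `A`; the terms of third order vanish by `hx`. Only the quadratic term survives. -/
theorem trace_mul_commutator_sub_one {A B : Matrix (Fin 2) (Fin 2) R} {x : R} (hx : x ^ 3 = 0)
    {p c : GL (Fin 2) R} (hp : (p : Matrix (Fin 2) (Fin 2) R) = 1 + x • B)
    (hc : c ∈ glCentralizer A) :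
    trace (A * ((((c * p)⁻¹ * (p * c) : GL (Fin 2) R) : Matrix (Fin 2) (Fin 2) R) - 1)) =
      -(x ^ 2 * trace (A * (B * ((c⁻¹ : GL (Fin 2) R).1 * B * c.1 - B)))) := by
  rw [commutator_eq_one_add_smul_inv_mul hp, add_sub_cancel_left]
  set D := (c⁻¹ : GL (Fin 2) R).1 * B * c.1 - B with hD
  have hAD : trace (A * D) = 0 := by
    have h1 : (c : Matrix (Fin 2) (Fin 2) R) * A * (c⁻¹ : GL (Fin 2) R).1 = A := by
      rw [← show A * (c : Matrix (Fin 2) (Fin 2) R) = c * A from hc]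
      exact Units.mul_inv_cancel_right A c
    rw [hD, mul_sub, trace_sub, ← mul_assoc, trace_mul_comm (A * _) c.1, ← mul_assoc, ← mul_assoc,
      h1, sub_self]
  have h3 : x * (x * x) = 0 := by rw [← hx]; ring
  rw [inv_mul_eq_sub hp, inv_mul_eq_sub hp (B * D)]
  simp only [smul_sub, smul_smul, mul_sub, mul_smul_comm, trace_sub, trace_smul, smul_eq_mul, hAD,
    h3, mul_zero, zero_mul, sub_zero]
  ring

end Commutator

/-! ### Reduction modulo the maximal ideal and congruence subgroups. -/

section Residue

variable {R : Type*} [CommRing R] [IsLocalRing R]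

/-- Reduction of matrices modulo the maximal ideal. -/
abbrev resMat : Matrix (Fin 2) (Fin 2) R →+* Matrix (Fin 2) (Fin 2) (ResidueField R) :=
  (residue R).mapMatrix

theorem resMat_surjective : Function.Surjective (resMat (R := R)) := by
  intro B
  choose f hf using fun i j => residue_surjective (B i j)
  exact ⟨Matrix.of f, Matrix.ext fun i j => hf i j⟩

theorem residue_trace (B : Matrix (Fin 2) (Fin 2) R) :
    residue R B.trace = (resMat B).trace := by
  simp [trace_fin_two]

theorem residue_det (B : Matrix (Fin 2) (Fin 2) R) :
    residue R B.det = (resMat B).det := by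
  simp [det_fin_two]

theorem resMat_smul (x : R) (B : Matrix (Fin 2) (Fin 2) R) :
    resMat (x • B) = residue R x • resMat B := by
  ext i j
  simp

theorem resMat_one_add {x : R} (hx : residue R x = 0) (B : Matrix (Fin 2) (Fin 2) R) :
    resMat (1 + x • B) = 1 := by
  rw [map_add, resMat_smul, hx, zero_smul, map_one, add_zero]

theorem exists_gl_eq_one_add {x : R} (hx : residue R x = 0) (B : Matrix (Fin 2) (Fin 2) R) :
    ∃ g : GL (Fin 2) R, (g : Matrix (Fin 2) (Fin 2) R) = 1 + x • B := by
  have h : IsUnit (1 + x • B).det := by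
    rw [← residue_ne_zero_iff_isUnit, residue_det, resMat_one_add hx, det_one]
    exact one_ne_zero
  exact ⟨((isUnit_iff_isUnit_det _).2 h).unit, rfl⟩

theorem resMat_inv_of_eq_one {g : GL (Fin 2) R} (h : resMat g.1 = 1) :
    resMat (g⁻¹ : GL (Fin 2) R).1 = 1 := by
  have h1 : resMat ((g⁻¹ : GL (Fin 2) R).1 * g.1) = 1 := by rw [Units.inv_mul, map_one]
  rwa [map_mul, h, mul_one] at h1

/-- The subgroup of matrices `1 + x B` with `B` modulo the maximal ideal in `𝔞`. -/
def residueCongruence {x : R} (hx : residue R x = 0)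
    (𝔞 : AddSubgroup (Matrix (Fin 2) (Fin 2) (ResidueField R))) : Subgroup (GL (Fin 2) R) where
  carrier := {g | ∃ B, (g : Matrix (Fin 2) (Fin 2) R) = 1 + x • B ∧ resMat B ∈ 𝔞}
  one_mem' := ⟨0, by simp, by rw [map_zero]; exact 𝔞.zero_mem⟩
  mul_mem' := by
    rintro g h ⟨B, hB, hB'⟩ ⟨C, hC, hC'⟩
    refine ⟨B + C + x • (B * C), ?_, ?_⟩
    · rw [Units.val_mul, hB, hC]
      simp only [mul_add, add_mul, one_mul, mul_one, smul_mul_assoc, mul_smul_comm]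
      module
    · rw [map_add, map_add, resMat_smul, hx, zero_smul, add_zero]
      exact 𝔞.add_mem hB' hC'
  inv_mem' := by
    rintro g ⟨B, hB, hB'⟩
    refine ⟨-((g⁻¹ : GL (Fin 2) R).1 * B), ?_, ?_⟩
    · have := inv_mul_eq_sub hB 1
      rw [mul_one, mul_one] at this
      rw [smul_neg, ← sub_eq_add_neg]
      exact this
    · rw [map_neg, map_mul, resMat_inv_of_eq_one (by rw [hB, resMat_one_add hx]), one_mul]
      exact 𝔞.neg_mem hB'

theorem residueCongruence_le {x : R} (hx : residue R x = 0)
    (𝔞 : AddSubgroup (Matrix (Fin 2) (Fin 2) (ResidueField R))) :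
    residueCongruence hx 𝔞 ≤ congruenceSubgroup x := by
  rintro g ⟨B, hB, -⟩
  exact ⟨B, hB⟩

theorem congruenceSubgroup_conj {R : Type*} [CommRing R] {x : R} {n : GL (Fin 2) R}
    (hn : n ∈ congruenceSubgroup x) (g : GL (Fin 2) R) : g⁻¹ * n * g ∈ congruenceSubgroup x := by
  obtain ⟨B, hB⟩ := hn
  exact ⟨_, conj_eq_one_add_smul hB g⟩

theorem congruenceSubgroup_le {R : Type*} [CommRing R] {x y : R} (h : x ∣ y) :
    congruenceSubgroup y ≤ congruenceSubgroup x := by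
  obtain ⟨z, rfl⟩ := h
  rintro g ⟨B, hB⟩
  exact ⟨z • B, by rw [hB, smul_smul]⟩

end Residue

/-! ### Cyclic matrices and their commutants. -/

section Cyclic

variable {R : Type*} [CommRing R]

/-- The determinant of the vectors `v`, `A v`. -/
def cyclicDet (A : Matrix (Fin 2) (Fin 2) R) (v : Fin 2 → R) : R :=
  v 0 * (A *ᵥ v) 1 - v 1 * (A *ᵥ v) 0

theorem IsCyclicMatrix.exists_isUnit {A : Matrix (Fin 2) (Fin 2) R} (hA : IsCyclicMatrix A) :
    ∃ v, IsUnit (cyclicDet A v) := by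
  obtain ⟨v, hv⟩ := hA
  refine ⟨v, ?_⟩
  have h : ∀ w : Fin 2 → R, ∃ a b : R, a • v + b • (A *ᵥ v) = w := fun w =>
    Submodule.mem_span_pair.1 (hv ▸ Submodule.mem_top : w ∈ Submodule.span R {v, A *ᵥ v})
  obtain ⟨a, b, h0⟩ := h ![1, 0]
  obtain ⟨c, d, h1⟩ := h ![0, 1]
  have h00 := congrFun h0 0
  have h01 := congrFun h0 1
  have h10 := congrFun h1 0
  have h11 := congrFun h1 1
  simp only [Pi.add_apply, Pi.smul_apply, smul_eq_mul, cons_val_zero, cons_val_one,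
    cons_val_fin_one] at h00 h01 h10 h11
  refine IsUnit.of_mul_eq_one (a * d - b * c) ?_
  unfold cyclicDet
  linear_combination (c * v 1 + d * (A *ᵥ v) 1) * h00 + h11 - (c * v 0 + d * (A *ᵥ v) 0) * h01

/-- A matrix which commutes with a cyclic matrix `A` up to `y`-torsion is, up to `y`-torsion,
a linear combination of `1` and `A`. -/
theorem exists_eq_of_smul_commutator {A : Matrix (Fin 2) (Fin 2) R} {v : Fin 2 → R}
    (hv : IsUnit (cyclicDet A v)) {y : R} {g : Matrix (Fin 2) (Fin 2) R}
    (hg : y • (A * g - g * A) = 0) : ∃ a b : R, y • (g - (a • 1 + b • A)) = 0 := by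
  obtain ⟨δ, hδ⟩ := hv
  have hδ' : ((δ⁻¹ : Rˣ) : R) * (v 0 * (A *ᵥ v) 1 - v 1 * (A *ᵥ v) 0) = 1 := by
    rw [← cyclicDet, ← hδ, Units.inv_mul]
  -- Cramer's rule for gv = a v + b Av in the basis v, Av. Then X = g − a − bA kills v and commutes
  -- with A up to `y`-torsion, so yX also kills Av and yX = 0.
  set a := ((δ⁻¹ : Rˣ) : R) * ((g *ᵥ v) 0 * (A *ᵥ v) 1 - (g *ᵥ v) 1 * (A *ᵥ v) 0) with ha
  set b := ((δ⁻¹ : Rˣ) : R) * (v 0 * (g *ᵥ v) 1 - v 1 * (g *ᵥ v) 0) with hb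
  refine ⟨a, b, ?_⟩
  generalize ((δ⁻¹ : Rˣ) : R) = u at *
  set X := g - (a • 1 + b • A) with hX
  have hXv : X *ᵥ v = 0 := by
    rw [hX, sub_mulVec, add_mulVec, smul_mulVec, smul_mulVec, one_mulVec]
    ext i
    simp only [Pi.sub_apply, Pi.add_apply, Pi.smul_apply, smul_eq_mul, Pi.zero_apply, ha, hb]
    fin_cases i
    · simp only [Fin.zero_eta, Fin.isValue]
      linear_combination (-(g *ᵥ v) 0) * hδ'
    · simp only [Fin.mk_one, Fin.isValue]
      linear_combination (-(g *ᵥ v) 1) * hδ'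
  have hXA : y • (X * A - A * X) = 0 := by
    have : X * A - A * X = -(A * g - g * A) := by
      rw [hX]
      simp only [sub_mul, mul_sub, add_mul, mul_add, smul_mul_assoc, mul_smul_comm, one_mul,
        mul_one]
      abel
    rw [this, smul_neg, hg, neg_zero]
  have hXw : y • (X *ᵥ (A *ᵥ v)) = 0 := by
    have h := congrArg (fun M => M *ᵥ v) hXA
    simp only [smul_mulVec, sub_mulVec, ← mulVec_mulVec, hXv, mulVec_zero, sub_zero,
      zero_mulVec] at h
    exact h
  generalize A *ᵥ v = w at *
  ext i j
  have h1 := congrFun hXv i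
  have h2 := congrFun hXw i
  simp only [mulVec, dotProduct, Fin.sum_univ_two, Pi.zero_apply, Pi.smul_apply, smul_eq_mul]
    at h1 h2
  simp only [Matrix.smul_apply, smul_eq_mul, Matrix.zero_apply]
  fin_cases j
  · simp only [Fin.zero_eta, Fin.isValue]
    linear_combination (u * w 1 * y) * h1 - (u * v 1) * h2 - y * X i 0 * hδ'
  · simp only [Fin.mk_one, Fin.isValue]
    linear_combination (u * v 0) * h2 - (u * w 0 * y) * h1 - y * X i 1 * hδ'

end Cyclic
end SL2Branching
end

noncomputable section
namespace SL2Branching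

open Matrix

/-- Modulo scalars `L` acts through the abelian group `C`, so its operators commute; by Schur they
are scalars and `W` is a line. -/
theorem IsIrrOn.of_scalar_mul {G V : Type*} [Group G] [AddCommGroup V] [Module ℂ V]
    [FiniteDimensional ℂ V] {ρ : Representation ℂ G V} {L C : Subgroup G} {W : Submodule ℂ V}
    (hW : IsIrrOn ρ L W) (hC : ∀ c ∈ C, ∀ c' ∈ C, c * c' = c' * c)
    (hL : ∀ g ∈ L, ∃ c ∈ C, ∃ z : ℂ, ∀ v ∈ W, ρ g v = z • ρ c v)
    {L' : Subgroup G} (hL' : L' ≤ L) : IsIrrOn ρ L' W := by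
  obtain ⟨w, hw, hw0⟩ := (Submodule.ne_bot_iff _).1 hW.ne_bot
  have hmem : ∀ g ∈ L, ∃ c ∈ C, ∃ z : ℂ, ∀ v ∈ W, ρ c v ∈ W ∧ ρ g v = z • ρ c v := by
    intro g hg
    obtain ⟨c, hc, z, hz⟩ := hL g hg
    have hz0 : z ≠ 0 := by
      rintro rfl
      refine hw0 ?_
      rw [← apply_inv_apply (ρ := ρ) g w, hz w hw, zero_smul, map_zero]
    refine ⟨c, hc, z, fun v hv => ⟨?_, hz v hv⟩⟩
    have h : ρ c v = z⁻¹ • ρ g v := by rw [hz v hv, smul_smul, inv_mul_cancel₀ hz0, one_smul]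
    rw [h]
    exact W.smul_mem _ (hW.stable g hg v hv)
  refine hW.of_commute (fun g hg h hh v hv => ?_) hL'
  obtain ⟨c, hc, z, hz⟩ := hmem g hg
  obtain ⟨c', hc', z', hz'⟩ := hmem h hh
  rw [map_mul, map_mul, Module.End.mul_apply, Module.End.mul_apply, (hz' v hv).2, (hz v hv).2,
    map_smul, map_smul, (hz _ (hz' v hv).1).2, (hz' _ (hz v hv).1).2, ← Module.End.mul_apply,
    ← map_mul, hC c hc c' hc', map_mul, Module.End.mul_apply, smul_comm]

variable {R : Type*} [CommRing R]

theorem addChar_ne_zero (ψ : AddChar R ℂ) (x : R) : ψ x ≠ 0 := (ψ.val_isUnit x).ne_zero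

/-- The function `g ↦ ψ (trace (A (g - 1)))` on a group of matrices. -/
def traceWeight (ψ : AddChar R ℂ) (A : Matrix (Fin 2) (Fin 2) R) (N : Subgroup (GL (Fin 2) R)) :
    N → ℂ :=
  fun n => ψ (trace (A * ((n : GL (Fin 2) R).1 - 1)))

/-- The eigenspace of `I + ϖ ^ l M₂(R)` for the character attached to `A`. -/
abbrev traceWeightSpace {V : Type*} [AddCommGroup V] [Module ℂ V]
    (ρ : Representation ℂ (GL (Fin 2) R) V) (ψ : AddChar R ℂ) (ϖ : R) (l : ℕ)
    (A : Matrix (Fin 2) (Fin 2) R) : Submodule ℂ V :=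
  weightSpace ρ (congruenceSubgroup (ϖ ^ l)) (traceWeight ψ A _)

/-! ### Weight spaces of congruence subgroups and the stabilizer of a cyclic character. -/

section Weights

variable {V : Type*} [AddCommGroup V] [Module ℂ V]
variable {ρ : Representation ℂ (GL (Fin 2) R) V} {ψ : AddChar R ℂ} {ϖ : R} {l : ℕ}
  {A : Matrix (Fin 2) (Fin 2) R} {v : Fin 2 → R}

theorem glCentralizer_comm (hv : IsUnit (cyclicDet A v)) {c c' : GL (Fin 2) R}
    (hc : c ∈ glCentralizer A) (hc' : c' ∈ glCentralizer A) : c * c' = c' * c := by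
  have hc : A * c.1 = c.1 * A := hc
  have hc' : A * c'.1 = c'.1 * A := hc'
  obtain ⟨a, b, hab⟩ := exists_eq_of_smul_commutator hv (y := 1) (g := c.1)
    (by rw [one_smul, hc, sub_self])
  rw [one_smul, sub_eq_zero] at hab
  ext1
  rw [Units.val_mul, Units.val_mul, hab]
  simp only [add_mul, mul_add, smul_mul_assoc, mul_smul_comm, one_mul, mul_one, hc']

theorem exists_eq_of_mem_glCentralizer (hv : IsUnit (cyclicDet A v)) {c : GL (Fin 2) R}
    (hc : c ∈ glCentralizer A) : ∃ a b : R, c.1 = a • 1 + b • A := by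
  obtain ⟨a, b, hab⟩ := exists_eq_of_smul_commutator hv (y := 1) (g := c.1)
    (by rw [one_smul, show A * c.1 = c.1 * A from hc, sub_self])
  rw [one_smul, sub_eq_zero] at hab
  exact ⟨a, b, hab⟩

theorem mem_glCentralizer_of_eq {c : GL (Fin 2) R} {a b : R} (h : c.1 = a • 1 + b • A) :
    c ∈ glCentralizer A := by
  change A * c.1 = c.1 * A
  rw [h]
  simp only [mul_add, add_mul, smul_mul_assoc, mul_smul_comm, one_mul, mul_one]

theorem RegularDatum.apply_of_mem (w : V) (hw : w ∈ traceWeightSpace ρ ψ ϖ l A) {n : GL (Fin 2) R}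
    (hn : n ∈ congruenceSubgroup (ϖ ^ l)) : ρ n w = ψ (trace (A * (n.1 - 1))) • w :=
  mem_weightSpace.1 hw ⟨n, hn⟩

theorem RegularDatum.apply_mul_of_commutator {w : V} (hw : w ∈ traceWeightSpace ρ ψ ϖ l A)
    {g g' : GL (Fin 2) R} (hn : (g' * g)⁻¹ * (g * g') ∈ congruenceSubgroup (ϖ ^ l)) :
    ρ (g * g') w = ψ (trace (A * (((g' * g)⁻¹ * (g * g') : GL (Fin 2) R).1 - 1))) •
      ρ (g' * g) w := by
  rw [← map_smul, ← RegularDatum.apply_of_mem w hw hn, ← Module.End.mul_apply, ← map_mul]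
  congr 2
  group

end Weights

variable [IsLocalRing R]
variable {V : Type*} [AddCommGroup V] [Module ℂ V]

/-- The setting of the irreducibility statements: over a ring of length `k + l`, the group `I` is
the stabilizer of the character of `I + ϖ ^ l M₂(R)` attached to the cyclic matrix `A`, and it acts
irreducibly on the corresponding eigenspace. -/
structure RegularDatum (ρ : Representation ℂ (GL (Fin 2) R) V) (ψ : AddChar R ℂ) (ϖ : R) (k l : ℕ)
    (A : Matrix (Fin 2) (Fin 2) R) (v : Fin 2 → R) (I : Subgroup (GL (Fin 2) R)) : Prop where
  chain : IsChainRing ϖ (k + l)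
  primitive : ψ (ϖ ^ (k + l - 1)) ≠ 1
  one_le : 1 ≤ k
  le : k ≤ l
  le_succ : l ≤ k + 1
  cyclic : IsUnit (cyclicDet A v)
  mem_iff : ∀ g : GL (Fin 2) R, g ∈ I ↔ ϖ ^ l • (A * g.1 - g.1 * A) = 0
  irr : IsIrrOn ρ I (traceWeightSpace ρ ψ ϖ l A)

section

variable {ρ : Representation ℂ (GL (Fin 2) R) V} {ψ : AddChar R ℂ} {ϖ : R} {k l : ℕ}
  {A : Matrix (Fin 2) (Fin 2) R} {v : Fin 2 → R} {I : Subgroup (GL (Fin 2) R)}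

theorem IsChainRing.exists_eq_smul_of_resMat {r : ℕ} (h : IsChainRing ϖ r)
    {D : Matrix (Fin 2) (Fin 2) R} (hD : resMat D = 0) : ∃ D', D = ϖ • D' := by
  have : ∀ i j, ∃ y, D i j = ϖ * y := fun i j =>
    h.residue_eq_zero_iff.1 (congrFun (congrFun hD i) j)
  choose f hf using this
  exact ⟨Matrix.of f, Matrix.ext hf⟩

namespace RegularDatum

theorem pow_ne_zero (h : RegularDatum ρ ψ ϖ k l A v I) : ϖ ^ (k + l - 1) ≠ 0 := fun h0 =>
  h.primitive (by rw [h0, AddChar.map_zero_eq_one])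

theorem residue_eq_zero (h : RegularDatum ρ ψ ϖ k l A v I) : residue R ϖ = 0 :=
  h.chain.residue_eq_zero_iff.2 dvd_rfl

theorem residue_pow (h : RegularDatum ρ ψ ϖ k l A v I) : residue R (ϖ ^ k) = 0 := by
  rw [map_pow, h.residue_eq_zero, zero_pow (by have := h.one_le; omega)]

theorem pow_three (h : RegularDatum ρ ψ ϖ k l A v I) : (ϖ ^ k) ^ 3 = 0 := by
  rw [← pow_mul]
  have := h.one_le
  have := h.le_succ
  exact h.chain.pow_eq_zero_of_le (by omega)

theorem glCentralizer_le (h : RegularDatum ρ ψ ϖ k l A v I) : glCentralizer A ≤ I := by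
  intro c hc
  rw [h.mem_iff, show A * c.1 = c.1 * A from hc, sub_self, smul_zero]

theorem congruenceSubgroup_le (h : RegularDatum ρ ψ ϖ k l A v I) :
    congruenceSubgroup (ϖ ^ k) ≤ I := by
  rintro m ⟨B, hB⟩
  have hz : ϖ ^ l * ϖ ^ k = 0 := by
    rw [← pow_add, add_comm]
    exact h.chain.pow_eq_zero
  rw [h.mem_iff, hB]
  simp only [mul_add, add_mul, mul_one, one_mul, mul_smul_comm, smul_mul_assoc, smul_sub, smul_add,
    smul_smul, hz, zero_smul, add_zero, sub_self]

/-- The annihilator of `ϖ ^ l` is generated by `ϖ ^ k`, so an element of `I` is congruent modulo `ϖ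
^ k` to a polynomial in `A`. -/
theorem exists_eq_mul (h : RegularDatum ρ ψ ϖ k l A v I) {g : GL (Fin 2) R} (hg : g ∈ I) :
    ∃ c ∈ glCentralizer A, ∃ m ∈ congruenceSubgroup (ϖ ^ k), g = c * m := by
  obtain ⟨a, b, hab⟩ := exists_eq_of_smul_commutator h.cyclic ((h.mem_iff g).1 hg)
  have hX : ∀ i j, ∃ y, (g.1 - (a • 1 + b • A)) i j = ϖ ^ k * y := fun i j => by
    have := h.chain.dvd_of_pow_mul_eq_zero h.pow_ne_zero (Nat.le_add_left l k)
      (congrFun (congrFun hab i) j)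
    rwa [Nat.add_sub_cancel] at this
  choose f hf using hX
  have hX : g.1 - (a • 1 + b • A) = ϖ ^ k • Matrix.of f := Matrix.ext hf
  -- With X = g − (a + bA), the factor m = 1 − g⁻¹X is chosen so that gm = a + bA.
  obtain ⟨m, hm⟩ := exists_gl_eq_one_add h.residue_pow (-((g⁻¹ : GL (Fin 2) R).1 * Matrix.of f))
  refine ⟨g * m, mem_glCentralizer_of_eq (a := a) (b := b) ?_, m⁻¹, inv_mem ⟨_, hm⟩, by group⟩
  rw [Units.val_mul, hm, mul_add, mul_one, mul_smul_comm, mul_neg, Units.mul_inv_cancel_left,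
    smul_neg, ← hX]
  abel

/-- The commutator of elements of `I + ϖ ^ k M₂(R)` acts through a scalar. -/
theorem apply_mul_congruence (h : RegularDatum ρ ψ ϖ k l A v I) {w : V}
    (hw : w ∈ traceWeightSpace ρ ψ ϖ l A) {p p' : GL (Fin 2) R}
    {B B' : Matrix (Fin 2) (Fin 2) R} (hp : p.1 = 1 + ϖ ^ k • B) (hp' : p'.1 = 1 + ϖ ^ k • B') :
    ρ (p * p') w = ψ ((ϖ ^ k) ^ 2 * trace (A * (B * B' - B' * B))) • ρ (p' * p) w := by
  have hc := commutator_eq_one_add_smul h.pow_three hp hp'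
  rw [apply_mul_of_commutator hw, hc, add_sub_cancel_left, mul_smul_comm, trace_smul, smul_eq_mul]
  refine SL2Branching.congruenceSubgroup_le (y := (ϖ ^ k) ^ 2) ?_ ⟨_, hc⟩
  rw [← pow_mul]
  have := h.one_le
  have := h.le_succ
  exact pow_dvd_pow _ (by omega)

/-- As 2k ≥ k + l − 1, the commutator scalar depends only on the residues of `A`, `B`, `B'`. -/
theorem apply_mul_comm (h : RegularDatum ρ ψ ϖ k l A v I) {w : V}
    (hw : w ∈ traceWeightSpace ρ ψ ϖ l A) {p p' : GL (Fin 2) R}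
    {B B' : Matrix (Fin 2) (Fin 2) R} (hp : p.1 = 1 + ϖ ^ k • B) (hp' : p'.1 = 1 + ϖ ^ k • B')
    (hB : (resMat A * (resMat B * resMat B' - resMat B' * resMat B)).trace = 0) :
    ρ (p * p') w = ρ (p' * p) w := by
  rw [h.apply_mul_congruence hw hp hp', ← pow_mul, h.chain.mul_eq_zero_of_residue,
    AddChar.map_zero_eq_one, one_smul]
  · have := h.le_succ
    omega
  · rw [residue_trace, map_mul, map_sub, map_mul, map_mul, hB]

/-! ### Unit trace: the centralizer consists of squares up to scalar action. -/

section TraceUnit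

/-- Elements of the centralizer of `A` which reduce to `1` act on the eigenspace by scalars. -/
theorem exists_scalar_of_resMat_eq_one [FiniteDimensional ℂ V]
    (h : RegularDatum ρ ψ ϖ k l A v I) {c : GL (Fin 2) R}
    (hc : c ∈ glCentralizer A) (hc1 : resMat c.1 = 1) :
    ∃ z : ℂ, ∀ w ∈ traceWeightSpace ρ ψ ϖ l A, ρ c w = z • w := by
  refine h.irr.exists_scalar (h.glCentralizer_le hc) fun g hg w hw => ?_
  obtain ⟨c', hc', m, ⟨Y, hY⟩, rfl⟩ := h.exists_eq_mul hg
  have hD : resMat ((c⁻¹ : GL (Fin 2) R).1 * Y * c.1 - Y) = 0 := by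
    rw [map_sub, map_mul, map_mul, hc1, resMat_inv_of_eq_one hc1, mul_one, one_mul, sub_self]
  -- The gained factor `ϖ` puts the commutator in I + ϖ^(k+1) M₂(R), hence in the group acting
  -- through the character, and its quadratic term carries ϖ^(2k+1) = 0.
  obtain ⟨D, hD⟩ := h.chain.exists_eq_smul_of_resMat hD
  have hcomm : ρ (m * c) w = ρ (c * m) w := by
    rw [apply_mul_of_commutator hw, trace_mul_commutator_sub_one h.pow_three hY hc, hD,
      mul_smul_comm, mul_smul_comm, trace_smul, smul_eq_mul, ← mul_assoc, ← pow_mul, ← pow_succ,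
      h.chain.pow_eq_zero_of_le (by have := h.le_succ; omega), zero_mul, neg_zero,
      AddChar.map_zero_eq_one, one_smul]
    refine SL2Branching.congruenceSubgroup_le (y := ϖ ^ (k + 1)) (pow_dvd_pow _ h.le_succ)
      ⟨(m⁻¹ : GL (Fin 2) R).1 * D, ?_⟩
    rw [commutator_eq_one_add_smul_inv_mul hY, hD, mul_smul_comm, smul_smul, pow_succ]
  rw [← mul_assoc, glCentralizer_comm h.cyclic hc hc', mul_assoc, map_mul, Module.End.mul_apply,
    ← hcomm, ← Module.End.mul_apply, ← map_mul, mul_assoc]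

/-- Over the residue field, (x + yA)² = (x² − y² det A) + y² tr(A) A in characteristic 2. As tr A is
invertible and every residue is a square, one solves for y and then for x. -/
theorem exists_mul_self_mul [Finite R] [CharP (ResidueField R) 2] (hv : IsUnit (cyclicDet A v))
    (ht : IsUnit A.trace) {c : GL (Fin 2) R} (hc : c ∈ glCentralizer A) :
    ∃ s ∈ glCentralizer A, ∃ c' ∈ glCentralizer A, resMat c'.1 = 1 ∧ c = s * s * c' := by
  obtain ⟨a, b, hab⟩ := exists_eq_of_mem_glCentralizer hv hc
  have := Finite.of_surjective _ (residue_surjective (R := R))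
  have hF := CharP.cast_eq_zero (ResidueField R) 2
  have hsq : ∀ x : ResidueField R, ∃ y : R, residue R y * residue R y = x := fun x => by
    obtain ⟨y, rfl⟩ := FiniteField.isSquare_of_char_two (ringChar.eq _ 2) x
    obtain ⟨z, rfl⟩ := residue_surjective y
    exact ⟨z, rfl⟩
  have ht0 : residue R A.trace ≠ 0 := (residue_ne_zero_iff_isUnit _).2 ht
  obtain ⟨y, hy⟩ := hsq (residue R b / residue R A.trace)
  obtain ⟨x, hx⟩ := hsq (residue R a + residue R y * residue R y * residue R A.det)
  have hs2 : resMat ((x • 1 + y • A) * (x • 1 + y • A)) = resMat c.1 := by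
    have h2 : (x • 1 + y • A) * (x • 1 + y • A) =
        (x * x - y * y * A.det) • 1 + (2 * x * y + y * y * A.trace) • A := by
      simp only [mul_add, add_mul, smul_mul_assoc, mul_smul_comm, one_mul, mul_one,
        mul_self_fin_two A]
      module
    have h3 : residue R (x * x - y * y * A.det) = residue R a := by
      rw [map_sub, map_mul, map_mul, map_mul, hx]; ring
    have h4 : residue R (2 * x * y + y * y * A.trace) = residue R b := by
      rw [map_add, map_mul, map_mul, map_mul, map_mul, hy, div_mul_cancel₀ _ ht0,
        show residue R 2 = 0 by rw [map_ofNat]; exact_mod_cast hF]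
      ring
    rw [h2, hab, map_add, map_add, resMat_smul, resMat_smul, resMat_smul, resMat_smul, h3, h4]
  have hu : IsUnit (x • 1 + y • A : Matrix (Fin 2) (Fin 2) R).det := by
    have h1 : IsUnit (c.1.det) := (isUnit_iff_isUnit_det _).1 c.isUnit
    rw [← residue_ne_zero_iff_isUnit, residue_det] at h1 ⊢
    rw [← hs2, map_mul, det_mul] at h1
    exact left_ne_zero_of_mul h1
  let s : GL (Fin 2) R := ((isUnit_iff_isUnit_det _).2 hu).unit
  have hs : s ∈ glCentralizer A := mem_glCentralizer_of_eq (a := x) (b := y) rfl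
  refine ⟨s, hs, (s * s)⁻¹ * c, mul_mem (inv_mem (mul_mem hs hs)) hc, ?_, by group⟩
  rw [Units.val_mul, map_mul, ← hs2, ← map_mul]
  have : (((s * s)⁻¹ : GL (Fin 2) R).1 * ((x • 1 + y • A) * (x • 1 + y • A))) = 1 :=
    (s * s).inv_mul
  rw [this, map_one]

/-- Up to operators that are scalar on the eigenspace, every element of `I` is a square times an
element of I + ϖ^k M₂(R), and `H` contains both kinds. -/
theorem isIrrOn_of_isUnit_trace [Finite R] [CharP (ResidueField R) 2] [FiniteDimensional ℂ V]
    (h : RegularDatum ρ ψ ϖ k l A v I) (ht : IsUnit A.trace) {H : Subgroup (GL (Fin 2) R)}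
    (hH : congruenceSubgroup (ϖ ^ k) ≤ H) (hsq : ∀ g, g * g ∈ H) :
    IsIrrOn ρ (H ⊓ I) (traceWeightSpace ρ ψ ϖ l A) := by
  refine h.irr.of_le inf_le_right fun U hU hUH g hg w hw => ?_
  obtain ⟨c, hc, m, hm, rfl⟩ := h.exists_eq_mul hg
  obtain ⟨s, hs, c', hc', hc1, rfl⟩ := exists_mul_self_mul h.cyclic ht hc
  obtain ⟨z, hz⟩ := h.exists_scalar_of_resMat_eq_one hc' hc1
  have hm' := hUH m ⟨hH hm, h.congruenceSubgroup_le hm⟩ w hw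
  rw [map_mul, map_mul, Module.End.mul_apply, Module.End.mul_apply, hz _ (hU hm')]
  exact hUH _ ⟨hsq s, h.glCentralizer_le (mul_mem hs hs)⟩ _ (U.smul_mem _ hm')

end TraceUnit

/-- If `k = l`, then every subgroup of `I` acts irreducibly on the eigenspace, as it is a line. -/
theorem isIrrOn_of_eq [FiniteDimensional ℂ V] (h : RegularDatum ρ ψ ϖ k k A v I)
    {L : Subgroup (GL (Fin 2) R)} (hL : L ≤ I) : IsIrrOn ρ L (traceWeightSpace ρ ψ ϖ k A) := by
  refine h.irr.of_scalar_mul (C := glCentralizer A)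
    (fun c hc c' hc' => glCentralizer_comm h.cyclic hc hc') (fun g hg => ?_) hL
  obtain ⟨c, hc, m, hm, rfl⟩ := h.exists_eq_mul hg
  refine ⟨c, hc, ψ (trace (A * (m.1 - 1))), fun w hw => ?_⟩
  rw [map_mul, Module.End.mul_apply, apply_of_mem w hw hm, map_smul]

end RegularDatum

end
end SL2Branching
end

noncomputable section
namespace SL2Branching

open Matrix

section Nilpotent

variable {F : Type*} [Field F]

/-- The line spanned by `n`. -/
def matLine (n : Matrix (Fin 2) (Fin 2) F) : AddSubgroup (Matrix (Fin 2) (Fin 2) F) :=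
  (Submodule.span F {n}).toAddSubgroup

/-- The orthogonal of `n` for the trace form. -/
def matOrthogonal (n : Matrix (Fin 2) (Fin 2) F) : AddSubgroup (Matrix (Fin 2) (Fin 2) F) where
  carrier := {B | trace (n * B) = 0}
  zero_mem' := by simp
  add_mem' {B C} hB hC := by
    simp only [Set.mem_ofPred_eq] at *
    rw [mul_add, trace_add, hB, hC, add_zero]
  neg_mem' {B} hB := by
    simp only [Set.mem_ofPred_eq] at *
    rw [mul_neg, trace_neg, hB, neg_zero]

theorem mem_matLine {n B : Matrix (Fin 2) (Fin 2) F} : B ∈ matLine n ↔ ∃ z : F, B = z • n := by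
  simp [matLine, Submodule.mem_span_singleton, eq_comm]

theorem mem_matOrthogonal {n B : Matrix (Fin 2) (Fin 2) F} :
    B ∈ matOrthogonal n ↔ trace (n * B) = 0 := Iff.rfl

end Nilpotent

variable {R : Type*} [CommRing R] [IsLocalRing R] {V : Type*} [AddCommGroup V] [Module ℂ V]
  {ρ : Representation ℂ (GL (Fin 2) R) V} {ψ : AddChar R ℂ} {ϖ : R} {k l : ℕ}
  {A : Matrix (Fin 2) (Fin 2) R} {v : Fin 2 → R} {I : Subgroup (GL (Fin 2) R)}

/-! ### Non-unit trace and odd length: polarization by the orthogonal of the nilpotent part. -/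

section Stabilizer

variable {G : Type*} [Group G]

/-- The stabilizer in `L` of a function on `N`. -/
def weightStabilizer (L N : Subgroup G) (hN : ∀ g ∈ L, ∀ n ∈ N, g⁻¹ * n * g ∈ N) (φ : N → ℂ) :
    Subgroup G where
  carrier := {g | g ∈ L ∧ ∀ n m : N, (m : G) = g⁻¹ * n * g → φ m = φ n}
  one_mem' := ⟨L.one_mem, fun n m h => by
    rw [Subtype.ext (show (m : G) = n by simpa using h)]⟩
  mul_mem' := by
    rintro g h ⟨hg, hgφ⟩ ⟨hh, hhφ⟩
    refine ⟨L.mul_mem hg hh, fun n m hm => ?_⟩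
    rw [← hgφ n ⟨_, hN g hg n n.2⟩ rfl]
    exact hhφ _ m (by rw [hm]; group)
  inv_mem' := by
    rintro g ⟨hg, hgφ⟩
    refine ⟨L.inv_mem hg, fun n m hm => ?_⟩
    exact (hgφ m n (by rw [hm]; group)).symm

theorem weightStabilizer_le (L N : Subgroup G) (hN : ∀ g ∈ L, ∀ n ∈ N, g⁻¹ * n * g ∈ N)
    (φ : N → ℂ) : weightStabilizer L N hN φ ≤ L := fun _ h => h.1

theorem mem_weightStabilizer {L N : Subgroup G} {hN : ∀ g ∈ L, ∀ n ∈ N, g⁻¹ * n * g ∈ N}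
    {φ : N → ℂ} {g : G} (hg : g ∈ L) :
    g ∈ weightStabilizer L N hN φ ↔ ∀ n : N, φ ⟨g⁻¹ * n * g, hN g hg n n.2⟩ = φ n := by
  refine ⟨fun h n => h.2 n _ rfl, fun h => ⟨hg, fun n m hm => ?_⟩⟩
  rw [← h n]
  congr 1
  exact Subtype.ext hm

end Stabilizer

namespace RegularDatum

/-- The matrix `A` may be replaced by a matrix congruent to it modulo `ϖ ^ k`. -/
theorem add_pow_smul (h : RegularDatum ρ ψ ϖ k l A v I) (X : Matrix (Fin 2) (Fin 2) R) :
    RegularDatum ρ ψ ϖ k l (A + ϖ ^ k • X) v I ∧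
      traceWeightSpace ρ ψ ϖ l (A + ϖ ^ k • X) = traceWeightSpace ρ ψ ϖ l A := by
  have hz : ϖ ^ l * ϖ ^ k = 0 := by
    rw [← pow_add, add_comm]
    exact h.chain.pow_eq_zero
  have hw : traceWeight ψ (A + ϖ ^ k • X) (congruenceSubgroup (ϖ ^ l)) = traceWeight ψ A _ := by
    funext ⟨n, B, hB⟩
    simp only [traceWeight, hB, add_sub_cancel_left, add_mul, mul_smul_comm, smul_mul_assoc,
      smul_add, smul_smul, hz, zero_smul, add_zero]
  have hW : traceWeightSpace ρ ψ ϖ l (A + ϖ ^ k • X) = traceWeightSpace ρ ψ ϖ l A := by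
    rw [traceWeightSpace, hw]
  refine ⟨⟨h.chain, h.primitive, h.one_le, h.le, h.le_succ, ?_, fun g => ?_, hW ▸ h.irr⟩, hW⟩
  · have hc := h.cyclic
    rw [← residue_ne_zero_iff_isUnit] at hc ⊢
    convert hc using 1
    simp [cyclicDet, mulVec, dotProduct, Fin.sum_univ_two, map_pow, h.residue_eq_zero,
      zero_pow (show k ≠ 0 by have := h.one_le; omega)]
  · rw [h.mem_iff]
    simp only [add_mul, mul_add, mul_smul_comm, smul_mul_assoc, smul_sub, smul_add, smul_smul, hz,
      zero_smul, add_zero]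

/-- Elements of the stabilizer commute with `A` modulo the maximal ideal. -/
theorem resMat_comm (h : RegularDatum ρ ψ ϖ k l A v I) {g : GL (Fin 2) R} (hg : g ∈ I) :
    resMat A * resMat g.1 = resMat g.1 * resMat A := by
  obtain ⟨c, hc, m, ⟨B, hB⟩, rfl⟩ := h.exists_eq_mul hg
  rw [Units.val_mul, map_mul, hB, resMat_one_add h.residue_pow, mul_one, ← map_mul,
    show A * c.1 = c.1 * A from hc, map_mul]

section Odd

variable {n : Matrix (Fin 2) (Fin 2) (ResidueField R)} {s : ResidueField R}

theorem conj_mem_matLine (h : RegularDatum ρ ψ ϖ k l A v I) (hA : resMat A = s • 1 + n)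
    {g p : GL (Fin 2) R} (hg : g ∈ I) (hp : p ∈ residueCongruence h.residue_pow (matLine n)) :
    g⁻¹ * p * g ∈ residueCongruence h.residue_pow (matLine n) := by
  obtain ⟨B, hB, hBn⟩ := hp
  obtain ⟨z, hz⟩ := mem_matLine.1 hBn
  refine ⟨_, conj_eq_one_add_smul hB g, mem_matLine.2 ⟨z, ?_⟩⟩
  have hc := h.resMat_comm hg
  rw [hA, add_mul, mul_add, smul_mul_assoc, mul_smul_comm, one_mul, mul_one, add_right_inj] at hc
  have h1 : resMat (g⁻¹ : GL (Fin 2) R).1 * resMat g.1 = 1 := by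
    rw [← map_mul, Units.inv_mul, map_one]
  rw [map_mul, map_mul, hz, mul_smul_comm, smul_mul_assoc, mul_assoc, hc, ← mul_assoc, h1, one_mul]

theorem conj_mem_matOrthogonal (h : RegularDatum ρ ψ ϖ k l A v I) (hA : resMat A = s • 1 + n)
    {g p : GL (Fin 2) R} (hg : g ∈ I)
    (hp : p ∈ residueCongruence h.residue_pow (matOrthogonal n)) :
    g⁻¹ * p * g ∈ residueCongruence h.residue_pow (matOrthogonal n) := by
  obtain ⟨B, hB, hBn⟩ := hp
  refine ⟨_, conj_eq_one_add_smul hB g, ?_⟩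
  have hc := h.resMat_comm hg
  rw [hA, add_mul, mul_add, smul_mul_assoc, mul_smul_comm, one_mul, mul_one, add_right_inj] at hc
  have h1 : resMat g.1 * resMat (g⁻¹ : GL (Fin 2) R).1 = 1 := by
    rw [← map_mul, Units.mul_inv, map_one]
  rw [mem_matOrthogonal, map_mul, map_mul, trace_mul_comm, mul_assoc, ← hc, ← mul_assoc,
    mul_assoc _ n, trace_mul_comm, ← mul_assoc, mul_assoc n, h1, mul_one]
  exact hBn

/-- The congruence subgroup attached to the nilpotent part of `A` acts through the character
attached to a suitable lift of `A`. -/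
theorem exists_lift [Finite R] [FiniteDimensional ℂ V] (h : RegularDatum ρ ψ ϖ k (k + 1) A v I)
    (hA : resMat A = s • 1 + n) (hn : n ≠ 0) (hnn : n * n = 0) :
    ∃ X, ∀ g ∈ residueCongruence h.residue_pow (matLine n),
      ∀ w ∈ traceWeightSpace ρ ψ ϖ (k + 1) A,
        ρ g w = ψ (trace ((A + ϖ ^ k • X) * (g.1 - 1))) • w := by
  set W := traceWeightSpace ρ ψ ϖ (k + 1) A with hW
  set K := residueCongruence h.residue_pow (matLine n) with hK
  have hAn : resMat A * n = n * resMat A := by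
    rw [hA, add_mul, mul_add, smul_mul_assoc, mul_smul_comm, one_mul, mul_one]
  have hKI : K ≤ I := (residueCongruence_le _ _).trans h.congruenceSubgroup_le
  have hK1 : congruenceSubgroup (ϖ ^ (k + 1)) ≤ K := by
    rintro g ⟨B, hB⟩
    refine ⟨ϖ • B, by rw [hB, smul_smul, pow_succ], ?_⟩
    rw [resMat_smul, h.residue_eq_zero, zero_smul]
    exact AddSubgroup.zero_mem _
  have hpow : ϖ ^ k * ϖ ^ k * ϖ = 0 := by
    rw [← pow_add, ← pow_succ]
    exact h.chain.pow_eq_zero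
  have hzero : ∀ x, residue R x = 0 → ϖ ^ k * ϖ ^ k * x = 0 := fun x hx => by
    rw [← pow_add]
    exact h.chain.mul_eq_zero_of_residue (by omega) hx
  -- Since n² = 0, the group `K` commutes on `W`, hence has a weight `κ` there. The aim is to write
  -- `κ` as the character of a corrected lift of `A`, and then to show that it is the only weight.
  obtain ⟨κ, hκ⟩ := exists_weight_vector (ρ := ρ) (N := K) (U := W) h.irr.ne_bot
    (h.irr.stable.mono hKI) (by
      rintro p ⟨B, hB, hBn⟩ p' ⟨B', hB', hBn'⟩ w hw
      obtain ⟨z, hz⟩ := mem_matLine.1 hBn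
      obtain ⟨z', hz'⟩ := mem_matLine.1 hBn'
      refine h.apply_mul_comm hw hB hB' ?_
      rw [hz, hz']
      simp [hnn])
  obtain ⟨w, ⟨hwW, hwκ⟩, hw0⟩ := (Submodule.ne_bot_iff _).1 hκ
  have hwκ : ∀ g : K, ρ g w = κ g • w := mem_weightSpace.1 hwκ
  have hκ1 : κ 1 = 1 := by
    have := hwκ 1
    rw [Subgroup.coe_one, map_one, Module.End.one_apply] at this
    exact (smul_left_injective ℂ hw0 (by simpa using this)).symm
  have hκmul : ∀ g g', κ (g * g') = κ g * κ g' := fun g g' => by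
    have := hwκ (g * g')
    rw [Subgroup.coe_mul, map_mul, Module.End.mul_apply, hwκ g', map_smul, hwκ g, smul_smul,
      mul_comm] at this
    exact (smul_left_injective ℂ hw0 this).symm
  have hκN : ∀ g : K, g.1 ∈ congruenceSubgroup (ϖ ^ (k + 1)) →
      κ g = ψ (trace (A * (g.1.1 - 1))) := fun g hg => by
    have := hwκ g
    rw [apply_of_mem w hwW hg] at this
    exact (smul_left_injective ℂ hw0 this).symm
  obtain ⟨n0, rfl⟩ := resMat_surjective n
  obtain ⟨X0, hX0⟩ := exists_trace_mul_eq_one hn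
  obtain ⟨X0, rfl⟩ := resMat_surjective X0
  have hg : ∀ z : R, ∃ g : K, g.1.1 = 1 + ϖ ^ k • (z • n0) := fun z => by
    obtain ⟨g, hg⟩ := exists_gl_eq_one_add h.residue_pow (z • n0)
    exact ⟨⟨g, _, hg, mem_matLine.2 ⟨residue R z, resMat_smul z n0⟩⟩, hg⟩
  choose γ hγ using hg
  have hnn0 : (ϖ ^ k * ϖ ^ k) • (n0 * n0) = 0 := by
    obtain ⟨Y, hY⟩ := h.chain.exists_eq_smul_of_resMat (D := n0 * n0) (by rw [map_mul, hnn])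
    rw [hY, smul_smul, hpow, zero_smul]
  have hγmul : ∀ z z', γ (z + z') = γ z * γ z' := fun z z' => by
    ext1
    ext1
    rw [Subgroup.coe_mul, Units.val_mul, hγ, hγ, hγ]
    have : (1 + ϖ ^ k • (z • n0)) * (1 + ϖ ^ k • (z' • n0)) =
        1 + ϖ ^ k • ((z + z') • n0) + (z * z') • ((ϖ ^ k * ϖ ^ k) • (n0 * n0)) := by
      simp only [mul_add, add_mul, smul_mul_assoc, mul_smul_comm, one_mul, mul_one]
      module
    rw [this, hnn0, smul_zero, add_zero]
  have hγ0 : γ 0 = 1 := by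
    ext1
    ext1
    rw [hγ]
    simp
  -- The ratio of `κ` to the character of `A` along 1 + ϖ^k z n₀. Additivity in z uses ϖ^(2k) n₀² =
  -- 0.
  let θ : AddChar R ℂ :=
    { toFun := fun z => κ (γ z) * ψ (-(ϖ ^ k * z * trace (A * n0)))
      map_zero_eq_one' := by simp [hγ0, hκ1]
      map_add_eq_mul' := fun z z' => by
        rw [hγmul, hκmul, mul_add, add_mul, neg_add, AddChar.map_add_eq_mul]
        ring }
  obtain ⟨y, hy⟩ := h.chain.exists_addChar_eq h.primitive θ
  have hθ : ∀ z, κ (γ z) = ψ (y * z + ϖ ^ k * z * trace (A * n0)) := fun z => by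
    rw [AddChar.map_add_eq_mul, ← hy]
    change _ = κ (γ z) * ψ (-(ϖ ^ k * z * trace (A * n0))) * _
    rw [mul_assoc, ← AddChar.map_add_eq_mul, neg_add_cancel, AddChar.map_zero_eq_one, mul_one]
  -- For z divisible by `ϖ` the element lies in I + ϖ^(k+1) M₂(R), where `κ` is already the
  -- character of `A`. So y is a multiple of ϖ^(2k), which a change of `A` by `ϖ ^ k • X` can
  -- absorb.
  have hyϖ : ϖ ^ 1 * y = 0 := by
    refine h.chain.eq_zero_of_addChar h.primitive fun z => ?_
    have h1 := hθ (ϖ * z)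
    rw [hκN _ ⟨z • n0, by rw [hγ]; module⟩, hγ, add_sub_cancel_left, mul_smul_comm, mul_smul_comm,
      trace_smul, trace_smul, AddChar.map_add_eq_mul] at h1
    have h2 : ϖ ^ k • (ϖ * z) • trace (A * n0) = ϖ ^ k * (ϖ * z) * trace (A * n0) := by
      rw [smul_eq_mul, smul_eq_mul]; ring
    rw [h2] at h1
    have h3 : ϖ ^ 1 * y * z = y * (ϖ * z) := by ring
    rw [h3]
    exact (mul_eq_right₀ (addChar_ne_zero _ _)).1 h1.symm
  obtain ⟨y, rfl⟩ := h.chain.dvd_of_pow_mul_eq_zero h.pow_ne_zero (by omega) hyϖ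
  have hexp : ϖ ^ (k + (k + 1) - 1) = ϖ ^ k * ϖ ^ k := by
    rw [← pow_add]
    congr 1
  rw [hexp] at hθ
  refine ⟨y • X0, ?_⟩
  have h' := (h.add_pow_smul (y • X0)).1
  set A' := A + ϖ ^ k • (y • X0) with hA'
  have hκA : ∀ g : K, κ g = ψ (trace (A' * (g.1.1 - 1))) := by
    rintro ⟨g, B, hB, hBn⟩
    obtain ⟨z, hz⟩ := mem_matLine.1 hBn
    obtain ⟨z, rfl⟩ := residue_surjective z
    obtain ⟨C, hC⟩ := h.chain.exists_eq_smul_of_resMat (D := B - z • n0)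
      (by rw [map_sub, resMat_smul, hz, sub_self])
    have hBC : B = z • n0 + ϖ • C := by rw [← hC]; abel
    obtain ⟨m, hm⟩ : ∃ m : K, m.1.1 = 1 + ϖ ^ (k + 1) • C := by
      obtain ⟨m, hm⟩ := exists_gl_eq_one_add (x := ϖ ^ (k + 1))
        (by rw [pow_succ, map_mul, h.residue_pow, zero_mul]) C
      exact ⟨⟨m, hK1 ⟨C, hm⟩⟩, hm⟩
    have hgm : (⟨g, B, hB, hBn⟩ : K) = γ z * m := by
      ext1
      ext1
      rw [Subgroup.coe_mul, Units.val_mul, hγ, hm, hB, hBC]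
      have : (1 + ϖ ^ k • (z • n0)) * (1 + ϖ ^ (k + 1) • C) =
          1 + ϖ ^ k • (z • n0 + ϖ • C) + (ϖ ^ k * ϖ ^ k * ϖ) • (z • (n0 * C)) := by
        simp only [mul_add, add_mul, smul_mul_assoc, mul_smul_comm, one_mul, mul_one]
        module
      rw [this, hpow, zero_smul, add_zero]
    rw [hgm, hκmul, hκN m ⟨C, hm⟩, hθ, ← AddChar.map_add_eq_mul, ← hgm, hm]
    change _ = ψ (trace (A' * (g.1 - 1)))
    congr 1
    have h1 : ϖ ^ k * ϖ ^ k * (trace (X0 * n0) - 1) = 0 := by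
      refine hzero _ ?_
      rw [map_sub, residue_trace, map_mul, trace_mul_comm, hX0, map_one, sub_self]
    rw [hB, add_sub_cancel_left, add_sub_cancel_left, hBC, hA']
    simp only [add_mul, mul_add, smul_mul_assoc, mul_smul_comm, trace_add, trace_smul, smul_eq_mul]
    linear_combination (-(y * z)) * h1 - (y * trace (X0 * C)) * hpow
  -- The factor in I + ϖ^k M₂(R) commutes with `K` on `W` because n commutes with A modulo `ϖ`; the
  -- factor centralizing `A'` fixes `κ`, now the character of `A'`. Irreducibility then spreads `κ`
  -- over `W`.
  have hstab : IsStable ρ I (W ⊓ weightSpace ρ K κ) := by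
    intro g hg u hu
    refine ⟨h.irr.stable g hg u hu.1, ?_⟩
    obtain ⟨c, hc, m, hm, rfl⟩ := h'.exists_eq_mul hg
    have hmI := h.congruenceSubgroup_le hm
    have hmu : ρ m u ∈ weightSpace ρ K κ := by
      refine mem_weightSpace.2 fun p => ?_
      obtain ⟨Y, hY⟩ := hm
      obtain ⟨p, B, hB, hBn⟩ := p
      obtain ⟨z, hz⟩ := mem_matLine.1 hBn
      have := h.apply_mul_comm hu.1 hB hY (by
        rw [hz, mul_sub, smul_mul_assoc, mul_smul_comm, ← mul_assoc, mul_smul_comm, hAn, trace_sub,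
          mul_smul_comm, trace_smul, trace_smul, ← mul_assoc, trace_mul_comm _ (resMat n0),
          ← mul_assoc, sub_self])
      rw [← Module.End.mul_apply, ← map_mul, this, map_mul, Module.End.mul_apply,
        mem_weightSpace.1 hu.2 ⟨p, B, hB, hBn⟩, map_smul]
    rw [map_mul, Module.End.mul_apply]
    refine apply_mem_weightSpace (fun p => ?_) hmu
    refine ⟨⟨_, h.conj_mem_matLine hA (h'.glCentralizer_le hc) p.2⟩, rfl, ?_⟩
    rw [hκA, hκA]
    congr 1
    have h1 : c.1 * A' * (c⁻¹ : GL (Fin 2) R).1 = A' := by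
      rw [← show A' * c.1 = c.1 * A' from hc]
      exact Units.mul_inv_cancel_right A' c
    have h2 : (c⁻¹ * p.1 * c : GL (Fin 2) R).1 - 1 =
        (c⁻¹ : GL (Fin 2) R).1 * (p.1.1 - 1) * c.1 := by
      rw [mul_sub, sub_mul, mul_one, Units.inv_mul, Units.val_mul, Units.val_mul]
    rw [h2, ← mul_assoc, trace_mul_comm _ c.1, ← mul_assoc, ← mul_assoc, h1]
  have heq := h.irr.eq_of_le _ inf_le_left hκ hstab
  intro g hg u hu
  have hu := heq.ge hu
  rw [mem_weightSpace.1 hu.2 ⟨g, hg⟩, hκA]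


/-- Modulo the maximal ideal c = α + bn and [B, n] = zn, so c⁻¹Bc − B = c⁻¹[B, c] = bz c⁻¹n, and
c⁻¹n = α⁻¹n. -/
theorem exists_resMat_conj_sub_eq (h : RegularDatum ρ ψ ϖ k l A v I) (hA : resMat A = s • 1 + n)
    (hn : n ≠ 0) (hnn : n * n = 0) {c : GL (Fin 2) R} (hc : c ∈ glCentralizer A)
    {B : Matrix (Fin 2) (Fin 2) R} (hB : resMat B ∈ matOrthogonal n) :
    ∃ z : ResidueField R, resMat ((c⁻¹ : GL (Fin 2) R).1 * B * c.1 - B) = z • n := by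
  obtain ⟨a, b, hab⟩ := exists_eq_of_mem_glCentralizer h.cyclic hc
  obtain ⟨z, hz⟩ := commutator_of_trace_eq_zero hn hnn hB
  obtain ⟨α, hα⟩ : ∃ α : ResidueField R, resMat c.1 = α • 1 + residue R b • n := by
    refine ⟨residue R a + residue R b * s, ?_⟩
    rw [hab, map_add, resMat_smul, resMat_smul, map_one, hA, smul_add, smul_smul, add_smul,
      add_assoc]
  have h1 : resMat (c⁻¹ : GL (Fin 2) R).1 * resMat c.1 = 1 := by
    rw [← map_mul, Units.inv_mul, map_one]
  have hcn : resMat c.1 * n = α • n := by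
    rw [hα, add_mul, smul_mul_assoc, smul_mul_assoc, hnn, one_mul, smul_zero, add_zero]
  have hα0 : α ≠ 0 := by
    rintro rfl
    rw [zero_smul] at hcn
    refine hn ?_
    rw [← one_mul n, ← h1, mul_assoc, hcn, mul_zero]
  have hcn' : resMat (c⁻¹ : GL (Fin 2) R).1 * n = α⁻¹ • n := by
    have h2 : n = α⁻¹ • (resMat c.1 * n) := by
      rw [hcn, smul_smul, inv_mul_cancel₀ hα0, one_smul]
    conv_lhs => rw [h2]
    rw [mul_smul_comm, ← mul_assoc, h1, one_mul]
  have hBc : resMat B * resMat c.1 = resMat c.1 * resMat B + (residue R b * z) • n := by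
    rw [mul_smul, ← hz, hα]
    simp only [mul_add, add_mul, smul_mul_assoc, mul_smul_comm, one_mul, mul_one, smul_sub]
    abel
  refine ⟨residue R b * z * α⁻¹, ?_⟩
  rw [map_sub, map_mul, map_mul, mul_assoc, hBc, mul_add, ← mul_assoc, h1, one_mul, mul_smul_comm,
    hcn', smul_smul]
  abel

/-- A weight space of the isotropic subgroup `P` has stabilizer C(A)P, acting through commuting
operators, so it is a line on which any subgroup is irreducible. It remains to recover `W` from it
inside `H ⊓ I`. -/
theorem isIrrOn_of_forall_apply [FiniteDimensional ℂ V]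
    (h : RegularDatum ρ ψ ϖ k (k + 1) A v I)
    (hA : resMat A = s • 1 + n) (hn : n ≠ 0) (hnn : n * n = 0)
    (hK : ∀ g ∈ residueCongruence h.residue_pow (matLine n),
      ∀ w ∈ traceWeightSpace ρ ψ ϖ (k + 1) A, ρ g w = ψ (trace (A * (g.1 - 1))) • w)
    {H : Subgroup (GL (Fin 2) R)} (hH : congruenceSubgroup (ϖ ^ k) ≤ H) :
    IsIrrOn ρ (H ⊓ I) (traceWeightSpace ρ ψ ϖ (k + 1) A) := by
  set W := traceWeightSpace ρ ψ ϖ (k + 1) A with hW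
  set P := residueCongruence h.residue_pow (matOrthogonal n) with hPdef
  have hPM : P ≤ congruenceSubgroup (ϖ ^ k) := residueCongruence_le _ _
  have hPI : P ≤ I := hPM.trans h.congruenceSubgroup_le
  have hPconj : ∀ g ∈ I, ∀ p ∈ P, g⁻¹ * p * g ∈ P := fun g hg p hp =>
    h.conj_mem_matOrthogonal hA hg hp
  have hAtr : ∀ B B' : Matrix (Fin 2) (Fin 2) (ResidueField R),
      trace (resMat A * (B * B' - B' * B)) = trace (n * (B * B' - B' * B)) := fun B B' => by
    rw [hA, add_mul, trace_add, smul_mul_assoc, one_mul, trace_smul, trace_sub,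
      trace_mul_comm B B', sub_self, smul_zero, zero_add]
  have hPcomm : ∀ m ∈ P, ∀ n ∈ P, ∀ w ∈ W, ρ (m * n) w = ρ (n * m) w := by
    rintro p ⟨B, hB, hBn⟩ p' ⟨B', hB', hBn'⟩ w hw
    exact h.apply_mul_comm hw hB hB' (by rw [hAtr, trace_mul_commutator hn hnn hBn hBn'])
  -- the centralizer of `A` commutes with the weight space of any character of `P`
  have hCP : ∀ c ∈ glCentralizer A, ∀ p ∈ P, ∀ w ∈ W, ρ (p * c) w = ρ (c * p) w := by
    rintro c hc p ⟨B, hB, hBn⟩ w hw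
    set D := (c⁻¹ : GL (Fin 2) R).1 * B * c.1 - B with hD
    obtain ⟨z, hz⟩ := h.exists_resMat_conj_sub_eq hA hn hnn hc hBn
    have hk := commutator_eq_one_add_smul_inv_mul hB c
    have hkK : (c * p)⁻¹ * (p * c) ∈ residueCongruence h.residue_pow (matLine n) := by
      refine ⟨_, hk, mem_matLine.2 ⟨z, ?_⟩⟩
      rw [map_mul, resMat_inv_of_eq_one (by rw [hB, resMat_one_add h.residue_pow]), one_mul, hz]
    have hpc : p * c = (c * p) * ((c * p)⁻¹ * (p * c)) := by group
    rw [hpc, map_mul, Module.End.mul_apply, hK _ hkK w hw,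
      trace_mul_commutator_sub_one h.pow_three hB hc, ← pow_mul, h.chain.mul_eq_zero_of_residue
      (by omega), neg_zero, AddChar.map_zero_eq_one, one_smul]
    have hBn : trace (n * resMat B) = 0 := hBn
    -- The commutator lies in `K`, where its character value is governed by tr(ABD) with D ≡ zn.
    -- This residue is zs tr(Bn) + z tr(nBn), and both terms vanish because tr(nB) = 0.
    rw [residue_trace, map_mul, map_mul, hz, mul_smul_comm, mul_smul_comm, trace_smul, hA, add_mul,
      trace_add, smul_mul_assoc, one_mul, trace_smul, trace_mul_comm (resMat B), hBn, ← mul_assoc,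
      mul_mul_fin_two, hBn, det_eq_zero_of_mul_self hnn]
    simp
  obtain ⟨φ, hφ⟩ := exists_weight_vector (ρ := ρ) (N := P) (U := W) h.irr.ne_bot
    (h.irr.stable.mono hPI) hPcomm
  set E := W ⊓ weightSpace ρ P φ with hE
  let St := weightStabilizer I P hPconj φ
  have hEirr : IsIrrOn ρ St E := h.irr.inf_weightSpace hPconj (weightStabilizer_le _ _ _ _) φ
    (fun g hg => mem_weightStabilizer hg) hφ
  have hCE : ∀ c ∈ glCentralizer A, ∀ w ∈ E, ρ c w ∈ E := by
    intro c hc w hw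
    refine ⟨h.irr.stable c (h.glCentralizer_le hc) w hw.1, mem_weightSpace.2 fun p => ?_⟩
    rw [← Module.End.mul_apply, ← map_mul, hCP c hc p p.2 w hw.1, map_mul, Module.End.mul_apply,
      mem_weightSpace.1 hw.2 p, map_smul]
  obtain ⟨w, hwE, hw0⟩ := (Submodule.ne_bot_iff _).1 hφ
  have hφ0 : ∀ p, φ p ≠ 0 := fun p hp => hw0 (by
    rw [← apply_inv_apply (ρ := ρ) p w, mem_weightSpace.1 hwE.2 p, hp, zero_smul, map_zero])
  have hSt : ∀ g ∈ St, ∃ c ∈ glCentralizer A, ∃ p ∈ P, g = c * p := by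
    intro g hg
    have hgI : g ∈ I := weightStabilizer_le _ _ _ _ hg
    obtain ⟨c, hc, m, ⟨Y, hY⟩, rfl⟩ := h.exists_eq_mul hgI
    refine ⟨c, hc, m, ⟨Y, hY, ?_⟩, rfl⟩
    -- Computing the action of 1 + ϖ^k B on ρ(cm)w in two ways: cm stabilizes `φ`, so the commutator
    -- with m must act trivially.
    have hψ : ∀ B, resMat B ∈ matOrthogonal n →
        ψ ((ϖ ^ k) ^ 2 * trace (A * (B * Y - Y * B))) = 1 := by
      intro B hB
      obtain ⟨p, hp⟩ := exists_gl_eq_one_add h.residue_pow B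
      have hpP : p ∈ P := ⟨B, hp, hB⟩
      have hmI : m ∈ I := h.congruenceSubgroup_le ⟨Y, hY⟩
      have h1 : ρ p (ρ (c * m) w) = φ ⟨p, hpP⟩ • ρ (c * m) w :=
        mem_weightSpace.1 (hEirr.stable _ hg w hwE).2 ⟨p, hpP⟩
      have h2 : ρ p (ρ (c * m) w) =
          (ψ ((ϖ ^ k) ^ 2 * trace (A * (B * Y - Y * B))) * φ ⟨p, hpP⟩) • ρ (c * m) w := by
        rw [map_mul ρ c m, Module.End.mul_apply, ← Module.End.mul_apply (ρ p), ← map_mul,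
          hCP c hc p hpP _ (h.irr.stable m hmI w hwE.1), map_mul, Module.End.mul_apply,
          ← Module.End.mul_apply (ρ p), ← map_mul, h.apply_mul_congruence hwE.1 hp hY, map_smul,
          map_mul ρ, Module.End.mul_apply, mem_weightSpace.1 hwE.2 ⟨p, hpP⟩, map_smul, map_smul,
          smul_smul]
      have hne : ρ (c * m) w ≠ 0 := fun h0 => hw0 (by
        rw [← apply_inv_apply (ρ := ρ) (c * m) w, h0, map_zero])
      have h3 := smul_left_injective ℂ hne (h1.symm.trans h2)
      exact (mul_eq_right₀ (hφ0 _)).1 h3.symm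
    obtain ⟨n0, rfl⟩ := resMat_surjective n
    obtain ⟨X0, hX0⟩ := exists_trace_mul_eq_one hn
    obtain ⟨X0, rfl⟩ := resMat_surjective X0
    -- Testing with B = z n₀X₀ suffices: n[nX₀, Y] has trace −tr(nX₀nY) = −tr(nY), so `Y` reduces
    -- into n^⊥.
    have hzero : (ϖ ^ k) ^ 2 * trace (A * (n0 * X0 * Y - Y * (n0 * X0))) = 0 := by
      refine h.chain.eq_zero_of_addChar h.primitive fun z => ?_
      have := hψ (z • (n0 * X0)) (by
        rw [resMat_smul, map_mul, mem_matOrthogonal, mul_smul_comm, ← mul_assoc, hnn, zero_mul,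
          smul_zero, trace_zero])
      rw [smul_mul_assoc, mul_smul_comm, ← smul_sub, mul_smul_comm, trace_smul, smul_eq_mul] at this
      rw [← this]
      congr 1
      ring
    have hres := h.chain.residue_eq_zero_of_mul h.pow_ne_zero (x := trace (A *
      (n0 * X0 * Y - Y * (n0 * X0)))) (by
        rw [← hzero, ← pow_mul]
        congr 2
        omega)
    rw [residue_trace] at hres
    simp only [map_mul, map_sub] at hres
    rw [hAtr] at hres
    have hnXn := mul_mul_fin_two (resMat n0) (resMat X0)
    rw [hX0, det_eq_zero_of_mul_self hnn, one_smul, zero_smul, sub_zero] at hnXn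
    rw [mul_sub, trace_sub, mul_assoc (resMat n0) (resMat X0), ← mul_assoc (resMat n0) (resMat n0),
      hnn, zero_mul, trace_zero, zero_sub, neg_eq_zero, ← mul_assoc, trace_mul_comm,
      ← mul_assoc, hnXn] at hres
    exact hres
  have hE' : IsIrrOn ρ (H ⊓ St) E := by
    refine hEirr.of_scalar_mul (C := glCentralizer A)
      (fun c hc c' hc' => glCentralizer_comm h.cyclic hc hc') (fun g hg => ?_) inf_le_right
    obtain ⟨c, hc, p, hp, rfl⟩ := hSt g hg
    refine ⟨c, hc, φ ⟨p, hp⟩, fun w hw => ?_⟩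
    rw [map_mul, Module.End.mul_apply, mem_weightSpace.1 hw.2 ⟨p, hp⟩, map_smul]
  refine isIrrOn_of_weightSpace (N := P) (inf_le_inf_left H (weightStabilizer_le _ _ _ _))
    (le_inf (hPM.trans hH) hPI) hPcomm (fun g hg => hPconj g hg.2) φ hE' inf_le_right le_rfl ?_
  -- `W` is the sum of the `I`-translates of `E`. As cm = (cmc⁻¹)c and c preserves `E`, translates
  -- by I + ϖ^k M₂(R), which lies in `H`, are enough.
  refine le_antisymm ?_ (orbitSup_le inf_le_left (h.irr.stable.mono inf_le_right))
  refine (h.irr.orbitSup_eq (inf_le_left : E ≤ W) hφ).ge.trans (iSup_le ?_)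
  rintro ⟨g, hg⟩ _ ⟨w, hw, rfl⟩
  obtain ⟨c, hc, m, hm, rfl⟩ := h.exists_eq_mul hg
  have hm' : c * m * c⁻¹ ∈ congruenceSubgroup (ϖ ^ k) := by
    simpa using congruenceSubgroup_conj hm c⁻¹
  refine Submodule.mem_iSup_of_mem ⟨c * m * c⁻¹, hH hm', h.congruenceSubgroup_le hm'⟩
    ⟨ρ c w, hCE c hc w hw, ?_⟩
  rw [← Module.End.mul_apply, ← map_mul, inv_mul_cancel_right]

end Odd

/-- In a finite field of characteristic 2, trace zero makes the characteristic polynomial X² + s², a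
square, so A − s has square zero modulo the maximal ideal. It is nonzero there because a scalar
matrix is not cyclic. -/
theorem isIrrOn_of_residue_trace_eq_zero [Finite R] [CharP (ResidueField R) 2]
    [FiniteDimensional ℂ V] (h : RegularDatum ρ ψ ϖ k (k + 1) A v I)
    (ht : residue R A.trace = 0)
    {H : Subgroup (GL (Fin 2) R)} (hH : congruenceSubgroup (ϖ ^ k) ≤ H) :
    IsIrrOn ρ (H ⊓ I) (traceWeightSpace ρ ψ ϖ (k + 1) A) := by
  have := Finite.of_surjective _ (residue_surjective (R := R))
  have hF : (2 : ResidueField R) = 0 := by exact_mod_cast CharP.cast_eq_zero (ResidueField R) 2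
  obtain ⟨s, hs⟩ := FiniteField.isSquare_of_char_two (ringChar.eq _ 2) (resMat A).det
  rw [residue_trace] at ht
  obtain ⟨n, hn⟩ : ∃ n, n = resMat A - s • 1 := ⟨_, rfl⟩
  have hA : resMat A = s • 1 + n := by rw [hn]; abel
  have hnn : n * n = 0 := by
    have h1 : n * n = resMat A * resMat A + (s * s) • 1 - (s + s) • resMat A := by
      rw [hn]
      simp only [sub_mul, mul_sub, smul_mul_assoc, mul_smul_comm, one_mul, mul_one, smul_sub,
        smul_smul, add_smul]
      abel
    rw [h1, mul_self_fin_two, ht, ← hs, ← two_mul, hF, zero_mul, zero_smul]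
    abel
  have hn0 : n ≠ 0 := by
    rintro rfl
    obtain ⟨s, rfl⟩ := residue_surjective s
    have hc := h.cyclic
    rw [← residue_ne_zero_iff_isUnit] at hc
    refine hc ?_
    have hij := fun i j => congrFun (congrFun hA i) j
    have h00 : residue R (A 0 0) = residue R s := by simpa using hij 0 0
    have h01 : residue R (A 0 1) = 0 := by simpa using hij 0 1
    have h10 : residue R (A 1 0) = 0 := by simpa using hij 1 0
    have h11 : residue R (A 1 1) = residue R s := by simpa using hij 1 1
    simp only [cyclicDet, mulVec, dotProduct, Fin.sum_univ_two, map_sub, map_add, map_mul, h00, h01,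
      h10, h11]
    ring
  obtain ⟨X, hX⟩ := h.exists_lift hA hn0 hnn
  obtain ⟨h', hW'⟩ := h.add_pow_smul X
  have hA' : resMat (A + ϖ ^ k • X) = s • 1 + n := by
    rw [map_add, resMat_smul, h.residue_pow, zero_smul, add_zero, hA]
  rw [← hW'] at hX ⊢
  exact h'.isIrrOn_of_forall_apply hA' hn0 hnn hX hH

end RegularDatum
end SL2Branching
end

noncomputable section
namespace SL2Branching

open Matrix

/-! ### Stabilizers of the characters of congruence subgroups. -/

section Stabilizer

variable {R : Type*} [CommRing R] [IsLocalRing R] {ϖ : R} {r : ℕ}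

theorem eq_zero_of_forall_trace_mul (h : IsChainRing ϖ r) {ψ : AddChar R ℂ}
    (hψ : ψ (ϖ ^ (r - 1)) ≠ 1) {Z : Matrix (Fin 2) (Fin 2) R}
    (hZ : ∀ B, ψ (trace (Z * B)) = 1) : Z = 0 := by
  ext i j
  refine h.eq_zero_of_addChar hψ fun y => ?_
  have := hZ (Matrix.single j i y)
  rwa [trace_mul_comm, trace_single_mul, smul_eq_mul, mul_comm] at this

/-- The stabilizer of the character of `I + ϖ ^ l M₂(R)` attached to `A`. -/
theorem traceWeight_conj_iff (h : IsChainRing ϖ r) {ψ : AddChar R ℂ}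
    (hψ : ψ (ϖ ^ (r - 1)) ≠ 1) {l : ℕ} (hl : l ≠ 0) (A : Matrix (Fin 2) (Fin 2) R)
    (g : GL (Fin 2) R) :
    (∀ n : congruenceSubgroup (ϖ ^ l), traceWeight ψ A (congruenceSubgroup (ϖ ^ l))
        ⟨g⁻¹ * n * g, congruenceSubgroup_conj n.2 g⟩ = traceWeight ψ A _ n) ↔
      ϖ ^ l • (A * g.1 - g.1 * A) = 0 := by
  have hϖ : residue R (ϖ ^ l) = 0 := by
    rw [map_pow, h.residue_eq_zero_iff.2 dvd_rfl, zero_pow hl]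
  set Z := g.1 * A * (g⁻¹ : GL (Fin 2) R).1 - A with hZdef
  have hZ : Z * g.1 = -(A * g.1 - g.1 * A) := by
    rw [hZdef, sub_mul, Units.inv_mul_cancel_right, neg_sub]
  have hiff : ϖ ^ l • (A * g.1 - g.1 * A) = 0 ↔ ϖ ^ l • Z = 0 := by
    rw [← neg_eq_zero, ← smul_neg, ← hZ, ← smul_mul_assoc]
    exact Units.mul_left_eq_zero g
  have key : ∀ (n : congruenceSubgroup (ϖ ^ l)) B, n.1.1 = 1 + ϖ ^ l • B →
      traceWeight ψ A (congruenceSubgroup (ϖ ^ l))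
        ⟨g⁻¹ * n * g, congruenceSubgroup_conj n.2 g⟩ =
      ψ (trace (ϖ ^ l • Z * B)) * traceWeight ψ A _ n := by
    intro n B hB
    simp only [traceWeight]
    rw [conj_eq_one_add_smul hB, hB, add_sub_cancel_left, add_sub_cancel_left,
      ← AddChar.map_add_eq_mul]
    congr 1
    have h1 : trace (A * ((g⁻¹ : GL (Fin 2) R).1 * B * g.1)) =
        trace (g.1 * A * (g⁻¹ : GL (Fin 2) R).1 * B) := by
      rw [← mul_assoc, trace_mul_comm, ← mul_assoc, ← mul_assoc]
    rw [mul_smul_comm, trace_smul, h1, hZdef, smul_mul_assoc, sub_mul, smul_sub, trace_sub,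
      trace_smul, trace_smul, mul_smul_comm, trace_smul, sub_add_cancel]
  rw [hiff]
  constructor
  · intro hn
    refine eq_zero_of_forall_trace_mul h hψ fun B => ?_
    obtain ⟨n, hB⟩ := exists_gl_eq_one_add hϖ B
    have h1 := hn ⟨n, B, hB⟩
    rw [key _ B hB] at h1
    exact (mul_eq_right₀ (addChar_ne_zero _ _)).1 h1
  · rintro hn ⟨n, B, hB⟩
    rw [key _ B hB, hn, zero_mul, trace_zero, AddChar.map_zero_eq_one, one_mul]

theorem congruenceSubgroup_comm {R : Type*} [CommRing R] {x : R} (hx : x * x = 0)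
    {m n : GL (Fin 2) R} (hm : m ∈ congruenceSubgroup x) (hn : n ∈ congruenceSubgroup x) :
    m * n = n * m := by
  obtain ⟨B, hB⟩ := hm
  obtain ⟨C, hC⟩ := hn
  ext1
  rw [Units.val_mul, Units.val_mul, hB, hC]
  simp only [mul_add, add_mul, smul_mul_assoc, mul_smul_comm, one_mul, mul_one, smul_add,
    smul_smul, hx, zero_smul]
  abel

end Stabilizer

/-! ### Square determinants and the passage to determinant one. -/

section SquareDeterminant

variable {R : Type*} [CommRing R]

/-- The matrices whose determinant is a square; these are the products of a scalar matrix and a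
matrix of determinant one. -/
def squareDet (R : Type*) [CommRing R] : Subgroup (GL (Fin 2) R) :=
  (powMonoidHom 2 : Rˣ →* Rˣ).range.comap Matrix.GeneralLinearGroup.det

instance : (squareDet R).Normal := Subgroup.Normal.comap inferInstance _

theorem mem_squareDet {g : GL (Fin 2) R} :
    g ∈ squareDet R ↔ ∃ u : Rˣ, u ^ 2 = Matrix.GeneralLinearGroup.det g := by
  simp [squareDet]

theorem mem_squareDet_of_isSquare {g : GL (Fin 2) R} (h : IsSquare g.1.det) :
    g ∈ squareDet R := by
  obtain ⟨y, hy⟩ := h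
  have hu : IsUnit g.1.det := (isUnit_iff_isUnit_det _).1 g.isUnit
  rw [hy] at hu
  obtain ⟨u, rfl⟩ := isUnit_of_mul_isUnit_left hu
  refine mem_squareDet.2 ⟨u, ?_⟩
  ext
  rw [Units.val_pow_eq_pow_val, pow_two, ← hy]
  rfl

theorem mul_self_mem_squareDet (g : GL (Fin 2) R) : g * g ∈ squareDet R :=
  mem_squareDet.2 ⟨Matrix.GeneralLinearGroup.det g, by rw [map_mul, pow_two]⟩

/-- The reason is det(1 + xB) = 1 + x(tr B + x det B). -/
theorem congruenceSubgroup_le_squareDet {x : R} (hx : ∀ y, IsSquare (1 + x * y)) :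
    congruenceSubgroup x ≤ squareDet R := by
  rintro g ⟨B, hB⟩
  refine mem_squareDet_of_isSquare ?_
  convert hx (B.trace + x * B.det) using 1
  rw [hB]
  simp only [det_fin_two, trace_fin_two, Matrix.add_apply, Matrix.smul_apply, smul_eq_mul,
    Matrix.one_apply_eq, Matrix.one_apply_ne (zero_ne_one : (0 : Fin 2) ≠ 1),
    Matrix.one_apply_ne (one_ne_zero : (1 : Fin 2) ≠ 0)]
  ring

/-- Scalar matrices act on an irreducible representation by scalars, so that the matrices with
square determinant and the matrices of determinant one have the same invariant subspaces. -/
theorem IsIrrOn.resSL {V : Type*} [AddCommGroup V] [Module ℂ V] [FiniteDimensional ℂ V]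
    {ρ : Representation ℂ (GL (Fin 2) R) V} (hρ : IsIrrOn ρ ⊤ ⊤) {W : Submodule ℂ V}
    (hW : IsIrrOn ρ (squareDet R) W) : IsIrrOn (resSL ρ) ⊤ W := by
  have hSL : ∀ g : SpecialLinearGroup (Fin 2) R,
      SpecialLinearGroup.toGL g ∈ squareDet R := fun g =>
    mem_squareDet.2 ⟨1, by simp⟩
  refine ⟨hW.ne_bot, fun g _ v hv => hW.stable _ (hSL g) v hv, fun U hU hU0 hUS => ?_⟩
  refine hW.eq_of_le U hU hU0 fun g hg v hv => ?_
  obtain ⟨u, hu⟩ := mem_squareDet.1 hg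
  obtain ⟨z, hz⟩ : ∃ z : GL (Fin 2) R, z.1 = u.1 • 1 :=
    ⟨Units.map (algebraMap R (Matrix (Fin 2) (Fin 2) R)).toMonoidHom u,
      Algebra.algebraMap_eq_smul_one _⟩
  obtain ⟨c, hc⟩ := hρ.exists_scalar (g := z) trivial fun h _ v _ => by
    congr 2
    ext1
    rw [Units.val_mul, Units.val_mul, hz, smul_mul_assoc, mul_smul_comm, one_mul, mul_one]
  have hdet : (z⁻¹ * g).1.det = 1 := by
    have h1 : z.1.det * (z⁻¹ * g).1.det = g.1.det := by
      rw [← det_mul, ← Units.val_mul, mul_inv_cancel_left]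
    have h2 : z.1.det = u.1 ^ 2 := by rw [hz, det_smul, det_one, mul_one, Fintype.card_fin]
    have h3 : g.1.det = u.1 ^ 2 := by
      rw [← Units.val_pow_eq_pow_val, hu]
      rfl
    rw [h2, h3] at h1
    exact ((u.isUnit.pow 2).mul_eq_left).1 h1
  have hg' : g = z * SpecialLinearGroup.toGL ⟨(z⁻¹ * g).1, hdet⟩ := by
    have : SpecialLinearGroup.toGL ⟨(z⁻¹ * g).1, hdet⟩ = z⁻¹ * g := by
      ext1
      rfl
    rw [this, mul_inv_cancel_left]
  rw [hg', map_mul, Module.End.mul_apply, hc _ trivial]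
  exact U.smul_mem c (hUS _ trivial v hv)

end SquareDeterminant

/-! ### Determinants from the centralizer when the trace is a unit. -/

section Norm

variable {R : Type*} [CommRing R] [IsLocalRing R] [Finite R] {ϖ : R} {r : ℕ}

/-- If the trace of `A` is a unit, then every unit is a norm from the centralizer of `A` up to
squares. -/
theorem exists_mul_glCentralizer [CharP (ResidueField R) 2]
    {A : Matrix (Fin 2) (Fin 2) R} (ht : IsUnit A.trace) (g : GL (Fin 2) R) :
    ∃ h ∈ squareDet R, ∃ c ∈ glCentralizer A, g = h * c := by
  have := Finite.of_surjective _ (residue_surjective (R := R))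
  have hgu : IsUnit g.1.det := (isUnit_iff_isUnit_det _).1 g.isUnit
  obtain ⟨a, ha⟩ := FiniteField.isSquare_of_char_two (ringChar.eq _ 2) (residue R g.1.det)
  obtain ⟨a, rfl⟩ := residue_surjective a
  have hau : IsUnit a := by
    rw [← residue_ne_zero_iff_isUnit] at hgu ⊢
    rw [ha] at hgu
    exact left_ne_zero_of_mul hgu
  obtain ⟨a, rfl⟩ := hau
  -- Since det(1 + bA) = 1 + b tr A + b² det A, this finds an element of the centralizer with
  -- determinant a⁻² det g, where a² and det g have the same residue.
  obtain ⟨b, -, hb⟩ := exists_quadratic_root ht A.det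
    (c := ((a⁻¹ : Rˣ) : R) ^ 2 * g.1.det - 1) (by
      rw [← IsLocalRing.residue_eq_zero_iff, map_sub, map_mul, ha, map_one, map_pow]
      have : residue R ((a⁻¹ : Rˣ) : R) * residue R a = 1 := by
        rw [← map_mul, Units.inv_mul, map_one]
      linear_combination (residue R ((a⁻¹ : Rˣ) : R) * residue R a + 1) * this)
  have hdet : ((1 : R) • 1 + b • A : Matrix (Fin 2) (Fin 2) R).det =
      ((a⁻¹ : Rˣ) : R) ^ 2 * g.1.det := by
    rw [trace_fin_two, det_fin_two A] at hb
    rw [det_fin_two ((1 : R) • 1 + b • A)]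
    simp only [ Matrix.add_apply, Matrix.smul_apply, smul_eq_mul,
      one_smul, Matrix.one_apply_eq, Matrix.one_apply_ne (zero_ne_one : (0 : Fin 2) ≠ 1),
      Matrix.one_apply_ne (one_ne_zero : (1 : Fin 2) ≠ 0)]
    linear_combination hb
  have hcu : IsUnit ((1 : R) • 1 + b • A : Matrix (Fin 2) (Fin 2) R).det :=
    hdet ▸ ((a⁻¹).isUnit.pow 2).mul hgu
  let c : GL (Fin 2) R := ((isUnit_iff_isUnit_det _).2 hcu).unit
  have hc : c.1.det = ((a⁻¹ : Rˣ) : R) ^ 2 * g.1.det := hdet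
  refine ⟨g * c⁻¹, mem_squareDet.2 ⟨a, ?_⟩, c, ?_, by group⟩
  · have h1 : Matrix.GeneralLinearGroup.det c = (a⁻¹) ^ 2 * Matrix.GeneralLinearGroup.det g := by
      ext
      exact hc
    rw [map_mul, map_inv, h1]
    rw [_root_.mul_inv_rev, mul_inv_cancel_left, inv_pow, inv_inv]
  · exact mem_glCentralizer_of_eq (a := 1) (b := b) rfl

end Norm
end SL2Branching
end

noncomputable section
namespace SL2Branching

open Matrix

/-! ### Decomposition of the restriction. -/

section SquareDeterminant

variable {R : Type*} [CommRing R] [IsLocalRing R] [Finite R] [CharP (ResidueField R) 2]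
variable {V : Type*} [AddCommGroup V] [Module ℂ V] [FiniteDimensional ℂ V]
variable {ρ : Representation ℂ (GL (Fin 2) R) V} {ψ : AddChar R ℂ} {ϖ : R} {k l : ℕ}
variable {A : Matrix (Fin 2) (Fin 2) R} {v : Fin 2 → R} {I : Subgroup (GL (Fin 2) R)}

namespace RegularDatum

theorem isIrrOn_squareDet_inf (h : RegularDatum ρ ψ ϖ k l A v I)
    (hsq : ∀ y, IsSquare (1 + ϖ ^ k * y)) :
    IsIrrOn ρ (squareDet R ⊓ I) (traceWeightSpace ρ ψ ϖ l A) := by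
  have hH := congruenceSubgroup_le_squareDet hsq
  by_cases ht : residue R A.trace = 0
  · obtain rfl | rfl : l = k ∨ l = k + 1 := by
      have h1 := h.le
      have h2 := h.le_succ
      omega
    · exact h.isIrrOn_of_eq inf_le_right
    · exact h.isIrrOn_of_residue_trace_eq_zero ht hH
  · exact h.isIrrOn_of_isUnit_trace (residue_ne_zero_iff_isUnit _ |>.1 ht) hH
      mul_self_mem_squareDet

theorem isIrrOn_orbitSup (h : RegularDatum ρ ψ ϖ k l A v I)
    (hsq : ∀ y, IsSquare (1 + ϖ ^ k * y)) :
    IsIrrOn ρ (squareDet R) (orbitSup ρ (squareDet R) (traceWeightSpace ρ ψ ϖ l A)) := by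
  have hsq' : ϖ ^ l * ϖ ^ l = 0 := by
    rw [← pow_add]
    exact h.chain.pow_eq_zero_of_le (Nat.add_le_add_right h.le l)
  exact isIrrOn_of_weightSpace inf_le_left
    ((SL2Branching.congruenceSubgroup_le (pow_dvd_pow ϖ h.le)).trans
      (congruenceSubgroup_le_squareDet hsq))
    (fun m hm n hn _ _ => by rw [congruenceSubgroup_comm hsq' hm hn])
    (fun g _ n hn => congruenceSubgroup_conj hn g) _ (h.isIrrOn_squareDet_inf hsq)
    le_rfl inf_le_right rfl

/-- The decomposition of `ρ` restricted to `SL₂(R)` into the translates of one irreducible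
subrepresentation. -/
theorem exists_resSL (h : RegularDatum ρ ψ ϖ k l A v I) (hρ : IsIrrOn ρ ⊤ ⊤)
    (hsq : ∀ y, IsSquare (1 + ϖ ^ k * y)) {D : Subgroup (GL (Fin 2) R)}
    (hHD : squareDet R ≤ D) (hID : I ≤ D) (hD : ∀ g ∈ D, ∃ h ∈ squareDet R, ∃ i ∈ I, g = h * i) :
    ∃ W : GL (Fin 2) R ⧸ D → Submodule ℂ V, iSupIndep W ∧ iSup W = ⊤ ∧
      ∀ x, IsIrrOn (resSL ρ) ⊤ (W x) ∧
        Module.finrank ℂ (W x) * D.index = Module.finrank ℂ V := by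
  have hl : l ≠ 0 := Nat.one_le_iff_ne_zero.1 (h.one_le.trans h.le)
  obtain ⟨W, hW, hW', hWx⟩ := exists_isInternal_of_weightSpace hρ
    (fun g n hn => congruenceSubgroup_conj hn g) (traceWeight ψ A (congruenceSubgroup (ϖ ^ l)))
    (fun g hg => (h.mem_iff g).2 ((traceWeight_conj_iff h.chain h.primitive hl A g).1 hg))
    h.irr.stable (h.isIrrOn_orbitSup hsq) h.irr.ne_bot hHD hID hD
  exact ⟨W, hW, hW', fun x => ⟨hρ.resSL (hWx x).1, (hWx x).2⟩⟩

/-- Every matrix is a product of one with square determinant and one centralizing `A`, so the group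
indexing the translates is everything and there is one summand. -/
theorem resSL_isIrreducible (h : RegularDatum ρ ψ ϖ k l A v I) (hρ : IsIrrOn ρ ⊤ ⊤)
    (hsq : ∀ y, IsSquare (1 + ϖ ^ k * y)) (ht : IsUnit A.trace) :
    (resSL ρ).IsIrreducible := by
  obtain ⟨W, -, -, hW⟩ := h.exists_resSL hρ hsq (D := ⊤) le_top le_top fun g _ => by
    obtain ⟨h', hh', c, hc, rfl⟩ := exists_mul_glCentralizer ht g
    exact ⟨h', hh', c, h.glCentralizer_le hc, rfl⟩
  obtain ⟨h1, h2⟩ := hW (QuotientGroup.mk 1)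
  rw [Subgroup.index_top, mul_one] at h2
  rw [Submodule.eq_top_of_finrank_eq h2] at h1
  exact h1.isIrreducible

theorem exists_isSumOfIrreducibles (h : RegularDatum ρ ψ ϖ k l A v I) (hρ : IsIrrOn ρ ⊤ ⊤)
    (hsq : ∀ y, IsSquare (1 + ϖ ^ k * y)) {D : Subgroup (GL (Fin 2) R)}
    (hHD : squareDet R ≤ D) (hID : I ≤ D) (hD : ∀ g ∈ D, ∃ h ∈ squareDet R, ∃ i ∈ I, g = h * i) :
    ∃ d, d * D.index = Module.finrank ℂ V ∧ IsSumOfIrreducibles (resSL ρ) D.index d := by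
  obtain ⟨W, hW, hW', hWx⟩ := h.exists_resSL hρ hsq hHD hID hD
  have e : GL (Fin 2) R ⧸ D ≃ Fin D.index := Finite.equivFinOfCardEq rfl
  refine ⟨_, (hWx (QuotientGroup.mk 1)).2, fun i =>
    ⟨W (e.symm i), fun g v hv => (hWx (e.symm i)).1.stable g trivial v hv⟩, ?_, fun i => ⟨?_, ?_⟩⟩
  · refine (DirectSum.isInternal_submodule_iff_iSupIndep_and_iSup_eq_top _).2
      ⟨hW.comp e.symm.injective, ?_⟩
    rw [← hW']
    exact e.symm.iSup_comp
  · exact IsIrrOn.toRepresentation_isIrreducible (hWx (e.symm i)).1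
  · have h0 : 0 < D.index := Nat.pos_of_ne_zero Subgroup.FiniteIndex.index_ne_zero
    exact Nat.eq_of_mul_eq_mul_right h0 ((hWx _).2.trans (hWx _).2.symm)

end RegularDatum

end SquareDeterminant

section Units

theorem card_units_add_card_maximalIdeal (R : Type*) [CommRing R] [IsLocalRing R] [Finite R] :
    Nat.card Rˣ + Nat.card (maximalIdeal R) = Nat.card R := by
  have h1 : (maximalIdeal R : Set R)ᶜ = Set.range (Units.val : Rˣ → R) := by
    ext x
    simp [IsUnit]
  rw [← Set.ncard_add_ncard_compl (maximalIdeal R : Set R), h1, add_comm,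
    ← Nat.card_coe_set_eq, ← Nat.card_coe_set_eq, Nat.card_range_of_injective Units.val_injective]
  rfl

end Units

/-! ### The determinant class group and its index. -/

section DeterminantClass

variable {R S : Type*} [CommRing R] [CommRing S] (f : R →+* S) (A : Matrix (Fin 2) (Fin 2) S)

/-- The matrices over `R` whose determinant is, over `S`, the determinant of an element of the
centralizer of `A`. -/
def detClass : Subgroup (GL (Fin 2) R) :=
  ((glCentralizer A).map (Matrix.GeneralLinearGroup.det : GL (Fin 2) S →* Sˣ)).comap
    ((Units.map (f : R →* S)).comp Matrix.GeneralLinearGroup.det)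

variable {f A}

theorem mem_detClass {g : GL (Fin 2) R} : g ∈ detClass f A ↔ ∃ c ∈ glCentralizer A,
    Matrix.GeneralLinearGroup.det c = Units.map (f : R →* S) (Matrix.GeneralLinearGroup.det g) :=
  Iff.rfl

theorem squareDet_le_detClass : squareDet R ≤ detClass f A := by
  intro g hg
  obtain ⟨u, hu⟩ := mem_squareDet.1 hg
  refine mem_detClass.2 ⟨Matrix.GeneralLinearGroup.scalar (Fin 2) (Units.map (f : R →* S) u),
    ?_, ?_⟩
  · exact (Matrix.scalar_commute _ (fun _ => Commute.all _ _) A).symm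
  · rw [Matrix.GeneralLinearGroup.det_scalar, ← hu, map_pow, Fintype.card_fin]

theorem comap_glCentralizer_le_detClass :
    (glCentralizer A).comap (Matrix.GeneralLinearGroup.map f) ≤ detClass f A := fun g hg =>
  mem_detClass.2 ⟨_, hg, Matrix.GeneralLinearGroup.map_det f g⟩

theorem map_surjective_of_isLocalHom (hf : Function.Surjective f) [IsLocalHom f] :
    Function.Surjective (Matrix.GeneralLinearGroup.map f : GL (Fin 2) R →* GL (Fin 2) S) := by
  intro g
  choose s hs using hf
  have hg : f.mapMatrix (g.1.map s) = g.1 := by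
    ext i j
    exact hs _
  have hu : IsUnit (g.1.map s) := by
    rw [isUnit_iff_isUnit_det, ← isUnit_map_iff f, RingHom.map_det, hg]
    exact (isUnit_iff_isUnit_det _).1 g.isUnit
  exact ⟨hu.unit, Units.ext hg⟩

/-- Lift the centralizing element c to i over `R`; then det(g i⁻¹) maps to 1, so it is a square by
`hsq`. -/
theorem exists_mul_of_mem_detClass (hf : Function.Surjective f) [IsLocalHom f]
    (hsq : ∀ x, f x = 1 → IsSquare x) {g : GL (Fin 2) R} (hg : g ∈ detClass f A) :
    ∃ h ∈ squareDet R, ∃ i ∈ (glCentralizer A).comap (Matrix.GeneralLinearGroup.map f),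
      g = h * i := by
  obtain ⟨c, hc, hcg⟩ := mem_detClass.1 hg
  obtain ⟨i, rfl⟩ := map_surjective_of_isLocalHom hf c
  refine ⟨g * i⁻¹, mem_squareDet_of_isSquare (hsq _ ?_), i, hc, (inv_mul_cancel_right g i).symm⟩
  have h1 : Units.map (f : R →* S) (Matrix.GeneralLinearGroup.det (g * i⁻¹)) = 1 := by
    rw [map_mul, map_mul, map_inv, map_inv, ← hcg, Matrix.GeneralLinearGroup.map_det]
    exact mul_inv_cancel _
  exact congrArg Units.val h1

theorem cardDetCentralizer_mul_index_detClass (hf : Function.Surjective f) [hl : IsLocalHom f] :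
    cardDetCentralizer A * (detClass f A).index = Nat.card Sˣ := by
  have hs : Function.Surjective ((Units.map (f : R →* S)).comp
      (Matrix.GeneralLinearGroup.det : GL (Fin 2) R →* Rˣ)) :=
    (surjective_units_map_of_local_ringHom f hf hl).comp
      Matrix.GeneralLinearGroup.det_surjective
  rw [detClass, Subgroup.index_comap_of_surjective _ hs]
  exact Subgroup.card_mul_index _

end DeterminantClass

/-! ### The quotients of the valuation ring. -/

section Quotient

variable {𝔬 : Type*} [CommRing 𝔬] [IsDomain 𝔬] [IsDiscreteValuationRing 𝔬]

theorem nontrivial_quo {k : ℕ} (hk : k ≠ 0) : Nontrivial (Quo 𝔬 k) :=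
  Ideal.Quotient.nontrivial_iff.2 fun h =>
    (maximalIdeal.isMaximal 𝔬).ne_top (top_le_iff.1 (h ▸ Ideal.pow_le_self hk))

theorem isLocalRing_quo {k : ℕ} (hk : k ≠ 0) : IsLocalRing (Quo 𝔬 k) :=
  have := nontrivial_quo (𝔬 := 𝔬) hk
  .of_surjective' _ Ideal.Quotient.mk_surjective

theorem finite_quo [Finite (ResidueField 𝔬)] (k : ℕ) : Finite (Quo 𝔬 k) :=
  have : Finite (𝔬 ⧸ maximalIdeal 𝔬) := ‹Finite (ResidueField 𝔬)›
  Ideal.finite_quotient_pow (IsNoetherian.noetherian _) k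

theorem isChainRing_quo {π : 𝔬} (hπ : Irreducible π) {k : ℕ} [IsLocalRing (Quo 𝔬 k)] :
    IsChainRing (Ideal.Quotient.mk (maximalIdeal 𝔬 ^ k) π) k where
  maximalIdeal_eq := by
    have := IsLocalHom.of_surjective (Ideal.Quotient.mk (maximalIdeal 𝔬 ^ k))
      Ideal.Quotient.mk_surjective
    ext x
    obtain ⟨x, rfl⟩ := Ideal.Quotient.mk_surjective x
    rw [mem_maximalIdeal, mem_nonunits_iff, isUnit_map_iff, ← mem_nonunits_iff,
      ← mem_maximalIdeal, ← Set.image_singleton, ← Ideal.map_span, ← hπ.maximalIdeal_eq]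
    refine ⟨fun h => Ideal.mem_map_of_mem _ h, fun h => ?_⟩
    obtain ⟨y, hy, hxy⟩ := (Ideal.mem_map_iff_of_surjective _ Ideal.Quotient.mk_surjective).1 h
    by_contra hx
    have hxu : IsUnit x := by simpa using hx
    have hyu : IsUnit y := by
      rw [← isUnit_map_iff (Ideal.Quotient.mk (maximalIdeal 𝔬 ^ k)), hxy, isUnit_map_iff]
      exact hxu
    exact hy hyu
  pow_eq_zero := pi_pow_eq_zero hπ le_rfl

theorem card_residueField_quo {k : ℕ} [IsLocalRing (Quo 𝔬 k)] :
    Nat.card (ResidueField (Quo 𝔬 k)) = Nat.card (ResidueField 𝔬) := by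
  have := IsLocalHom.of_surjective (Ideal.Quotient.mk (maximalIdeal 𝔬 ^ k))
    Ideal.Quotient.mk_surjective
  refine (Nat.card_congr (Equiv.ofBijective
    (ResidueField.map (Ideal.Quotient.mk (maximalIdeal 𝔬 ^ k))) ⟨RingHom.injective _, ?_⟩)).symm
  intro x
  obtain ⟨x, rfl⟩ := residue_surjective x
  obtain ⟨x, rfl⟩ := Ideal.Quotient.mk_surjective x
  exact ⟨residue 𝔬 x, rfl⟩

theorem charP_residueField_quo [CharP (ResidueField 𝔬) 2] {k : ℕ} [IsLocalRing (Quo 𝔬 k)] :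
    CharP (ResidueField (Quo 𝔬 k)) 2 := by
  have := IsLocalHom.of_surjective (Ideal.Quotient.mk (maximalIdeal 𝔬 ^ k))
    Ideal.Quotient.mk_surjective
  exact charP_of_injective_ringHom
    (ResidueField.map (Ideal.Quotient.mk (maximalIdeal 𝔬 ^ k))).injective 2

theorem card_units_quo [Finite (ResidueField 𝔬)] {k : ℕ} (hk : k ≠ 0) :
    (Nat.card (Quo 𝔬 k)ˣ : ℚ) =
      ((Nat.card (ResidueField 𝔬) : ℚ) - 1) * (Nat.card (ResidueField 𝔬) : ℚ) ^ (k - 1) := by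
  obtain ⟨k, rfl⟩ := Nat.exists_eq_succ_of_ne_zero hk
  rw [Nat.succ_eq_add_one, Nat.add_sub_cancel]
  have := isLocalRing_quo (𝔬 := 𝔬) k.succ_ne_zero
  have := finite_quo (𝔬 := 𝔬) (k + 1)
  have hR : Nat.card (Quo 𝔬 (k + 1)) = Nat.card (ResidueField 𝔬) ^ (k + 1) :=
    cardQuot_pow_of_prime (IsDiscreteValuationRing.not_a_field 𝔬)
  have h1 := card_units_add_card_maximalIdeal (Quo 𝔬 (k + 1))
  have h2 := Submodule.card_eq_card_quotient_mul_card (maximalIdeal (Quo 𝔬 (k + 1)))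
  have h3 : Nat.card (Quo 𝔬 (k + 1) ⧸ maximalIdeal (Quo 𝔬 (k + 1))) =
    Nat.card (ResidueField 𝔬) := card_residueField_quo
  have h4 : 0 < Nat.card (ResidueField 𝔬) := Nat.card_pos
  rw [h3, hR, pow_succ] at h2
  rw [hR, ← Nat.eq_of_mul_eq_mul_right h4 h2] at h1
  have h5 : (Nat.card (Quo 𝔬 (k + 1))ˣ : ℚ) + (Nat.card (ResidueField 𝔬) : ℚ) ^ k =
    (Nat.card (ResidueField 𝔬) : ℚ) ^ (k + 1) := by exact_mod_cast h1
  linear_combination h5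

/-- Cancelling π^(r−k) in the domain identifies the kernel of reduction with an annihilator.
Congruences modulo π^k thus become equations in 𝔬_r, the form used in `RegularDatum`. -/
theorem factorPow_eq_zero_iff {π : 𝔬} (hπ : Irreducible π) {k r : ℕ} (hkr : k ≤ r) {x : Quo 𝔬 r} :
    Ideal.Quotient.factorPow (maximalIdeal 𝔬) hkr x = 0 ↔
      Ideal.Quotient.mk (maximalIdeal 𝔬 ^ r) π ^ (r - k) * x = 0 := by
  obtain ⟨x, rfl⟩ := Ideal.Quotient.mk_surjective x
  rw [Ideal.Quotient.factor_mk, ← map_pow, ← map_mul, Ideal.Quotient.eq_zero_iff_mem,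
    Ideal.Quotient.eq_zero_iff_mem, hπ.maximalIdeal_eq, Ideal.span_singleton_pow,
    Ideal.span_singleton_pow, Ideal.mem_span_singleton, Ideal.mem_span_singleton]
  conv_rhs => rw [show π ^ r = π ^ (r - k) * π ^ k by rw [← pow_add, Nat.sub_add_cancel hkr]]
  exact (mul_dvd_mul_iff_left (pow_ne_zero _ hπ.ne_zero)).symm

theorem dvd_of_factorPow_eq_zero {π : 𝔬} (hπ : Irreducible π) {k r : ℕ} (hkr : k ≤ r) {x : Quo 𝔬 r}
    (hx : Ideal.Quotient.factorPow (maximalIdeal 𝔬) hkr x = 0) :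
    Ideal.Quotient.mk (maximalIdeal 𝔬 ^ r) π ^ k ∣ x := by
  obtain ⟨x, rfl⟩ := Ideal.Quotient.mk_surjective x
  rw [Ideal.Quotient.factor_mk, Ideal.Quotient.eq_zero_iff_mem, hπ.maximalIdeal_eq,
    Ideal.span_singleton_pow, Ideal.mem_span_singleton] at hx
  rw [← map_pow]
  exact map_dvd _ hx

theorem map_matrixLift {k r : ℕ} (hkr : k ≤ r) (A : Matrix (Fin 2) (Fin 2) (Quo 𝔬 k)) :
    (matrixLift r A).map (Ideal.Quotient.factorPow (maximalIdeal 𝔬) hkr) = A := by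
  ext i j
  exact Quotient.out_eq (A i j)

theorem exists_regularDatum [Finite (ResidueField 𝔬)] {π : 𝔬} (hπ : Irreducible π) {r : ℕ}
    (hr : 2 ≤ r) [IsLocalRing (Quo 𝔬 r)] {ψ : AddChar (Quo 𝔬 r) ℂ}
    (hψ : ψ (Ideal.Quotient.mk (maximalIdeal 𝔬 ^ r) (π ^ (r - 1))) ≠ 1)
    {A : Matrix (Fin 2) (Fin 2) (Quo 𝔬 (r / 2))} (hA : IsCyclicMatrix A)
    {V : Type*} [AddCommGroup V] [Module ℂ V] [FiniteDimensional ℂ V]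
    {ρ : Representation ℂ (GL (Fin 2) (Quo 𝔬 r)) V}
    (hρ : IsIrrOver (charRep (psiA hπ ψ A)) ρ) :
    ∃ v, RegularDatum ρ ψ (Ideal.Quotient.mk (maximalIdeal 𝔬 ^ r) π) (r / 2) ((r + 1) / 2)
      (matrixLift r A) v ((glCentralizer A).comap (Matrix.GeneralLinearGroup.map
        (Ideal.Quotient.factorPow (maximalIdeal 𝔬) (Nat.div_le_self r 2)))) := by
  have hkl : r / 2 + (r + 1) / 2 = r := by omega
  have hlr : r - r / 2 = (r + 1) / 2 := by omega
  have := nontrivial_quo (𝔬 := 𝔬) (k := r / 2) (by omega)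
  set f := Ideal.Quotient.factorPow (maximalIdeal 𝔬) (Nat.div_le_self r 2) with hf
  have hfs : Function.Surjective f := Ideal.Quotient.factor_surjective _
  have := IsLocalHom.of_surjective f hfs
  have hchain : IsChainRing (Ideal.Quotient.mk (maximalIdeal 𝔬 ^ r) π) r := isChainRing_quo hπ
  rw [map_pow] at hψ
  have hlift : f.mapMatrix (matrixLift r A) = A := map_matrixLift _ A
  have hmem : ∀ g : GL (Fin 2) (Quo 𝔬 r),
      g ∈ (glCentralizer A).comap (Matrix.GeneralLinearGroup.map f) ↔
        Ideal.Quotient.mk (maximalIdeal 𝔬 ^ r) π ^ ((r + 1) / 2) •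
          (matrixLift r A * g.1 - g.1 * matrixLift r A) = 0 := by
    intro g
    have h1 : g ∈ (glCentralizer A).comap (Matrix.GeneralLinearGroup.map f) ↔
        f.mapMatrix (matrixLift r A * g.1 - g.1 * matrixLift r A) = 0 := by
      rw [map_sub, map_mul, map_mul, hlift, sub_eq_zero]
      rfl
    rw [h1, ← Matrix.ext_iff, ← Matrix.ext_iff]
    refine forall₂_congr fun i j => ?_
    rw [Matrix.smul_apply, smul_eq_mul, ← hlr]
    exact factorPow_eq_zero_iff hπ (Nat.div_le_self r 2)
  obtain ⟨w, hw⟩ := hA.exists_isUnit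
  obtain ⟨v, rfl⟩ : ∃ v : Fin 2 → Quo 𝔬 r, f ∘ v = w :=
    ⟨fun i => (hfs (w i)).choose, funext fun i => (hfs (w i)).choose_spec⟩
  refine ⟨v, ⟨hkl.symm ▸ hchain, by rwa [hkl], by omega, by omega, by omega, ?_, hmem, ?_⟩⟩
  · rw [← isUnit_map_iff f]
    convert hw using 1
    conv_rhs => rw [← hlift]
    simp [cyclicDet, Matrix.mulVec, dotProduct]
  · have hne := hρ.weightSpace_ne_bot _ fun g n hn => congruenceSubgroup_conj hn g
    have := (IsIrrOver.isIrrOn_top hρ.1).inf_weightSpace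
      (I := (glCentralizer A).comap (Matrix.GeneralLinearGroup.map f))
      (fun g _ n hn => congruenceSubgroup_conj hn g) le_top
      (traceWeight ψ (matrixLift r A) (congGL π r ((r + 1) / 2)))
      (fun g _ => (hmem g).trans
        (traceWeight_conj_iff hchain hψ (by omega) (matrixLift r A) g).symm)
      (by rw [top_inf_eq]; exact hne)
    rwa [top_inf_eq] at this

theorem exists_two_eq_unit_mul {π : 𝔬} (hπ : Irreducible π) {e : ℕ}
    (he : Ideal.span {(2 : 𝔬)} = maximalIdeal 𝔬 ^ e) : ∃ u : 𝔬ˣ, (2 : 𝔬) = u * π ^ e := by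
  rw [hπ.maximalIdeal_eq, Ideal.span_singleton_pow, Ideal.span_singleton_eq_span_singleton] at he
  obtain ⟨u, hu⟩ := he.symm
  exact ⟨u, by rw [← hu, mul_comm]⟩

end Quotient

end SL2Branching
end

theorem theorem1p2 {𝔬 : Type*} [CommRing 𝔬] [IsDomain 𝔬] [IsDiscreteValuationRing 𝔬]
    [TopologicalSpace 𝔬] [CompactSpace 𝔬] (hadic : IsAdic (IsLocalRing.maximalIdeal 𝔬))
    [Finite (IsLocalRing.ResidueField 𝔬)] [CharP (IsLocalRing.ResidueField 𝔬) 2] [CharZero 𝔬]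
    (e : ℕ) (he : Ideal.span {(2 : 𝔬)} = IsLocalRing.maximalIdeal 𝔬 ^ e)
    (π : 𝔬) (hπ : Irreducible π) (r : ℕ) (hr : 4 * e + 2 ≤ r)
    (ψ : AddChar (SL2Branching.Quo 𝔬 r) ℂ)
    (hψ : ψ (Ideal.Quotient.mk (IsLocalRing.maximalIdeal 𝔬 ^ r) (π ^ (r - 1))) ≠ 1)
    (A : Matrix (Fin 2) (Fin 2) (SL2Branching.Quo 𝔬 (r / 2)))
    (hA : SL2Branching.IsCyclicMatrix A)
    {V : Type*} [AddCommGroup V] [Module ℂ V] [FiniteDimensional ℂ V]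
    (ρ : Representation ℂ (GL (Fin 2) (SL2Branching.Quo 𝔬 r)) V)
    (hρ : SL2Branching.IsIrrOver (SL2Branching.charRep (SL2Branching.psiA hπ ψ A)) ρ) :
    (IsUnit A.trace → (SL2Branching.resSL ρ).IsIrreducible) ∧
    (A.trace ∈ Ideal.span {Ideal.Quotient.mk (IsLocalRing.maximalIdeal 𝔬 ^ (r / 2)) π} →
      ∃ n d : ℕ,
        (n : ℚ) = ((Nat.card (IsLocalRing.ResidueField 𝔬) : ℚ) - 1) *
            (Nat.card (IsLocalRing.ResidueField 𝔬) : ℚ) ^ (r / 2 - 1) /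
            (SL2Branching.cardDetCentralizer A : ℚ) ∧
        (d : ℚ) = (Module.finrank ℂ V : ℚ) * (SL2Branching.cardDetCentralizer A : ℚ) /
            (((Nat.card (IsLocalRing.ResidueField 𝔬) : ℚ) - 1) *
              (Nat.card (IsLocalRing.ResidueField 𝔬) : ℚ) ^ (r / 2 - 1)) ∧
        SL2Branching.IsSumOfIrreducibles (SL2Branching.resSL ρ) n d) := by
  open SL2Branching in
  have hk : r / 2 ≠ 0 := by omega
  have := isLocalRing_quo (𝔬 := 𝔬) (k := r) (by omega)
  have := nontrivial_quo (𝔬 := 𝔬) hk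
  have := finite_quo (𝔬 := 𝔬) r
  have := finite_quo (𝔬 := 𝔬) (r / 2)
  have := charP_residueField_quo (𝔬 := 𝔬) (k := r)
  obtain ⟨v, h⟩ := exists_regularDatum hπ (by omega) hψ hA hρ
  set f := Ideal.Quotient.factorPow (IsLocalRing.maximalIdeal 𝔬) (Nat.div_le_self r 2)
  have hfs : Function.Surjective f := Ideal.Quotient.factor_surjective _
  have := IsLocalHom.of_surjective f hfs
  obtain ⟨u, hu⟩ := exists_two_eq_unit_mul hπ he
  -- The only use of r ≥ 4e + 2 in its full strength: it gives ⌊r/2⌋ ≥ 2e + 1.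
  have hsq : ∀ y, IsSquare
      (1 + Ideal.Quotient.mk (IsLocalRing.maximalIdeal 𝔬 ^ r) π ^ (r / 2) * y) :=
    (isChainRing_quo hπ).isSquare_one_add
      (u := Units.map (Ideal.Quotient.mk (IsLocalRing.maximalIdeal 𝔬 ^ r)).toMonoidHom u)
      (e := e) (by
        have := congrArg (Ideal.Quotient.mk (IsLocalRing.maximalIdeal 𝔬 ^ r)) hu
        rwa [map_mul, map_pow, map_ofNat] at this)
      (by omega)
  have hirr := IsIrrOver.isIrrOn_top hρ.1
  refine ⟨fun ht => h.resSL_isIrreducible hirr hsq ?_, fun _ => ?_⟩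
  · rw [← map_matrixLift (Nat.div_le_self r 2) A] at ht
    rw [← isUnit_map_iff f]
    convert ht using 1
    exact AddMonoidHom.map_trace f.toAddMonoidHom (matrixLift r A)
  · obtain ⟨d, hd, hsum⟩ := h.exists_isSumOfIrreducibles hirr hsq (D := detClass f A)
      squareDet_le_detClass comap_glCentralizer_le_detClass
      fun g hg => exists_mul_of_mem_detClass hfs (fun x hx => by
        obtain ⟨y, hy⟩ := dvd_of_factorPow_eq_zero hπ (Nat.div_le_self r 2) (x := x - 1)
          (by rw [map_sub, map_one]; exact sub_eq_zero.2 hx)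
        rw [← add_sub_cancel 1 x, hy]
        exact hsq y) hg
    have hn := cardDetCentralizer_mul_index_detClass (A := A) hfs
    have hcard := card_units_quo (𝔬 := 𝔬) hk
    rw [← hn] at hcard
    push_cast at hcard
    -- The product is the order of the finite unit group of 𝔬_⌊r/2⌋, so both factors are nonzero and
    -- may be divided out.
    have hpos : (cardDetCentralizer A : ℚ) * ((detClass f A).index : ℚ) ≠ 0 := by
      rw [← Nat.cast_mul, hn]
      exact Nat.cast_ne_zero.2 Nat.card_pos.ne'
    have hc := left_ne_zero_of_mul hpos
    have hi := right_ne_zero_of_mul hpos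
    refine ⟨_, d, ?_, ?_, hsum⟩
    · rw [← hcard, mul_div_cancel_left₀ _ hc]
    · rw [← hcard, ← hd]
      push_cast
      field_simp
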